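/- Let $\Delta$ be a thick building of type $\mathsf{A}_r$, regarded as a numbered simplicial complex with type set $I=\{1,\dots,r\}$ (Bourbaki labelling), and let $J\subsetneq I$. For opposite simplices $F,F'$ that are not chambers, the perspectivity $\mathsf{proj}^F_{F'}\colon \mathsf{Res}(F)\to\mathsf{Res}(F')$ is the isomorphism of residues induced by mapping each chamber through $F$ to the unique chamber through $F'$ at minimal gallery distance from it. A self-projectivity of $F$ is a composition of perspectivities along a sequence $F=F_0,F_1,\dots,F_\ell=F$ of consecutively opposite simplices; it is even if it can be so written with $\ell$ even. Let $\Pi(F)$ be the group of all self-projectivities of $F$, let $\Pi^+(F)$ be the subgroup of the even ones, and put $n(J)=[\Pi(F):\Pi^+(F)]$ for a simplex $F$ of type $J$. Let $J^\equiv$ be the set of types opposite to those in $J$. The polar type of a Coxeter complex of type $\mathsf{A}_m$ ($m\ge 1$) is the type of the centre of a root, i.e. of the unique nonempty simplex in the root fixed by all (not necessarily type-preserving) automorphisms preserving that root; the polar types of a residue are those of the connected components of its diagram. The set $J$ is polar closed if it can be partitioned into an ordered sequence $J_1,\dots,J_s$ ($s\ge 0$) of singletons and pairs such that each $J_\ell$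 is a polar type in the residue of a simplex of type $J_1\cup\dots\cup J_{\ell-1}$. Then: (i) $J$ is polar closed if and only if, for some integer $0\le k\le\frac{r-1}{2}$, $|J|=2k$ and $J=\{1,2,\dots,k,\,r-k+1,r-k+2,\dots,r\}$. (ii) For every simplex $F$ of type $J$, $[\Pi(F):\Pi^+(F)]=1$ (that is, $n(J)=1$) if and only if either $J^\equiv\neq J$, or $|J|=2k$ and $J=\{1,2,\dots,k,\,r-k+1,\dots,r\}$ for some integer $0\le k\le\frac{r-1}{2}$. (iii) If $J$ is polar closed, then for every simplex $F$ of type $J$ the identity of $\mathsf{Res}(F)$ is a product of three perspectivities: there are simplices $F',F''$ such that $F,F',F''$ are pairwise opposite and $\mathsf{proj}^{F''}_{F}\circ\mathsf{proj}^{F'}_{F''}\circ\mathsf{proj}^{F}_{F'}=\mathrm{id}$. -/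

import Mathlib

/-! ### The Coxeter complex of type `A_r` -/

/-- Vertices of the Coxeter complex of type `A_r`: the proper nonempty subsets of `{0, …, r}`.
With `W = Sym {0, …, r}` and `P_i` the stabiliser of `{0, …, i - 1}` (the maximal parabolic subgroup
omitting the `i`-th generator), the coset `w P_i` corresponds to the subset `w {0, …, i - 1}`. -/
def CoxVertex (r : ℕ) : Type :=
  {A : Finset (Fin (r + 1)) // A.Nonempty ∧ A ≠ Finset.univ}

namespace CoxVertex

variable {r : ℕ}

/-- The type of a vertex in the Bourbaki labelling `1, …, r` of the diagram. -/
def typ (x : CoxVertex r) : ℕ := x.1.card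

/-- Simplices: sets of pairwise nested subsets (cosets with a common element), the empty one
included. -/
def IsSimplex (F : Set (CoxVertex r)) : Prop :=
  ∀ x ∈ F, ∀ y ∈ F, x.1 ⊆ y.1 ∨ y.1 ⊆ x.1

/-- The root (half apartment) attached to the ordered pair `i ≠ j`: the image of the folding that
replaces a subset containing `j` but not `i` by its image under the reflection `(i j)`. -/
def root (i j : Fin (r + 1)) : Set (CoxVertex r) := {x | j ∈ x.1 → i ∈ x.1}

/-- The wall bounding the root of `(i, j)`: its intersection with the opposite root. -/
def wall (i j : Fin (r + 1)) : Set (CoxVertex r) := root i j ∩ root j i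

/-- Opposite vertices: distinct vertices such that every wall containing the first
contains the second. -/
def OppVertex (x y : CoxVertex r) : Prop :=
  x ≠ y ∧ ∀ i j : Fin (r + 1), i ≠ j → x ∈ wall i j → y ∈ wall i j

/-- Opposite simplices of the Coxeter complex. -/
def Opp (F G : Set (CoxVertex r)) : Prop :=
  IsSimplex F ∧ IsSimplex G ∧
    (∀ x ∈ F, ∀ y, OppVertex x y → y ∈ G) ∧ (∀ y ∈ G, ∀ x, OppVertex y x → x ∈ F)

/-- Automorphisms of the Coxeter complex, not necessarily type preserving. -/
def IsAut (g : Equiv.Perm (CoxVertex r)) : Prop :=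
  ∀ F : Set (CoxVertex r), IsSimplex (g '' F) ↔ IsSimplex F

/-- `F` is the centre of the root `α`: the nonempty simplex contained in `α` that is fixed by each
automorphism preserving `α`. -/
def IsCentre (α F : Set (CoxVertex r)) : Prop :=
  IsSimplex F ∧ F.Nonempty ∧ F ⊆ α ∧
    ∀ g : Equiv.Perm (CoxVertex r), IsAut g → g '' α = α → g '' F = F

end CoxVertex

/-- The set `J^≡` of types opposite to the types in `J`. -/
def oppTypes (r : ℕ) (J : Set ℕ) : Set ℕ :=
  {t | ∃ x y : CoxVertex r, CoxVertex.OppVertex x y ∧ x.typ ∈ J ∧ y.typ = t}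

/-- `T` is a polar type of the Coxeter complex of type `A_m`: the type of the centre of a root. -/
def IsPolarType (m : ℕ) (T : Set ℕ) : Prop :=
  ∃ i j : Fin (m + 1), i ≠ j ∧ ∃ F : Set (CoxVertex m),
    CoxVertex.IsCentre (CoxVertex.root i j) F ∧ CoxVertex.typ '' F = T

/-- `{a, …, b}` is a connected component of the diagram induced on `{1, …, r} \ K`, the diagram of
type `A_r` being the path `1 - 2 - ⋯ - r`. -/
def IsComponent (r : ℕ) (K : Set ℕ) (a b : ℕ) : Prop :=
  a ≤ b ∧ Set.Icc a b ⊆ Set.Icc 1 r \ K ∧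
    a - 1 ∉ Set.Icc 1 r \ K ∧ b + 1 ∉ Set.Icc 1 r \ K

/-- `T` is a polar type in the residue of a simplex of type `K`: the polar type of a component
`{a, …, b}` of the diagram of that residue; the component has type `A_(b-a+1)`, its nodes being
relabelled by the shift `t ↦ t + (a - 1)`. -/
def IsPolarTypeInResidue (r : ℕ) (K T : Set ℕ) : Prop :=
  ∃ a b : ℕ, IsComponent r K a b ∧
    ∃ T₀ : Set ℕ, IsPolarType (b - a + 1) T₀ ∧ T = (fun t => t + (a - 1)) '' T₀

/-- Polar closed sets of types: `J` is partitioned into an ordered sequence of singletons and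
pairs, each of them a polar type in the residue of the union of the preceding ones. -/
inductive PolarClosed (r : ℕ) : Set ℕ → Prop
  | empty : PolarClosed r ∅
  | step (J T : Set ℕ) : PolarClosed r J → Disjoint J T → (T.ncard = 1 ∨ T.ncard = 2) →
      IsPolarTypeInResidue r J T → PolarClosed r (J ∪ T)

/-! ### Buildings of type `A_r` -/

/-- A numbered simplicial complex on the vertex set `V` with type set `{1, …, r}`; the empty
simplex is included. -/
structure NumberedComplex (r : ℕ) (V : Type*) where
  simplices : Set (Set V)
  typ : V → ℕ
  empty_mem : ∅ ∈ simplices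
  singleton_mem : ∀ v, {v} ∈ simplices
  down_closed : ∀ F ∈ simplices, ∀ G, G ⊆ F → G ∈ simplices
  typ_mem : ∀ v, typ v ∈ Set.Icc 1 r
  typ_injOn : ∀ F ∈ simplices, Set.InjOn typ F

namespace NumberedComplex

variable {r : ℕ} {V : Type*} (Δ : NumberedComplex r V)

/-- Chambers: the simplices with a vertex of each type. -/
def IsChamber (C : Set V) : Prop := C ∈ Δ.simplices ∧ Δ.typ '' C = Set.Icc 1 r

/-- Panels: the simplices of size `r - 1`. -/
def IsPanel (P : Set V) : Prop := P ∈ Δ.simplices ∧ P.ncard + 1 = r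

/-- `e` is a type preserving isomorphism of the Coxeter complex of type `A_r` onto the
complex `A`. -/
def IsChart (A : Set (Set V)) (e : CoxVertex r → V) : Prop :=
  Function.Injective e ∧ (∀ x, Δ.typ (e x) = x.typ) ∧
    A = {F | ∃ F₀ : Set (CoxVertex r), CoxVertex.IsSimplex F₀ ∧ F = e '' F₀}

end NumberedComplex

/-- A (thick) building of type `A_r`. -/
structure BuildingA (r : ℕ) (V : Type*) extends NumberedComplex r V where
  apartments : Set (Set (Set V))
  apartment_subset : ∀ A ∈ apartments, A ⊆ simplices
  /-- apartments are isomorphic to the Coxeter complex -/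
  exists_chart : ∀ A ∈ apartments, ∃ e, toNumberedComplex.IsChart A e
  /-- any two simplices lie in a common apartment -/
  exists_apartment : ∀ F ∈ simplices, ∀ G ∈ simplices, ∃ A ∈ apartments, F ∈ A ∧ G ∈ A
  /-- two apartments containing `F` and `G` are isomorphic, by the isomorphism `e' ∘ e⁻¹`, which
  fixes every vertex of `F` and of `G` -/
  exists_iso : ∀ A ∈ apartments, ∀ A' ∈ apartments, ∀ F G : Set V,
    F ∈ A → G ∈ A → F ∈ A' → G ∈ A' →
      ∃ e e', toNumberedComplex.IsChart A e ∧ toNumberedComplex.IsChart A' e' ∧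
        ∀ x, e x ∈ F ∪ G → e' x = e x
  /-- every panel lies in at least three chambers -/
  thick : ∀ P, toNumberedComplex.IsPanel P →
    3 ≤ {C | toNumberedComplex.IsChamber C ∧ P ⊆ C}.encard

namespace BuildingA

variable {r : ℕ} {V : Type*} (Δ : BuildingA r V)

/-- The chamber graph: chambers are adjacent when they meet in a panel. -/
def chamberGraph : SimpleGraph {C : Set V // Δ.IsChamber C} where
  Adj C D := C ≠ D ∧ Δ.IsPanel (C.1 ∩ D.1)
  symm := ⟨fun C D h => ⟨h.1.symm, by rw [Set.inter_comm]; exact h.2⟩⟩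
  loopless := ⟨fun _ h => h.1 rfl⟩

/-- Opposite simplices: opposite in some apartment. -/
def Opposite (F G : Set V) : Prop :=
  ∃ A ∈ Δ.apartments, ∃ e, Δ.IsChart A e ∧
    ∃ F₀ G₀ : Set (CoxVertex r), CoxVertex.Opp F₀ G₀ ∧ F = e '' F₀ ∧ G = e '' G₀

/-- The vertices of the residue of `F`: the vertices joinable to `F`. -/
def Residue (F : Set V) : Type _ := {v : V // v ∉ F ∧ insert v F ∈ Δ.simplices}

/-- `C'` is the projection of the chamber `C` onto `F'`: a chamber through `F'` at minimal gallery
distance from `C`. -/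
def IsProjection (F' : Set V) (C C' : {C : Set V // Δ.IsChamber C}) : Prop :=
  F' ⊆ C'.1 ∧ ∀ D : {C : Set V // Δ.IsChamber C}, F' ⊆ D.1 →
    Δ.chamberGraph.dist C C' ≤ Δ.chamberGraph.dist C D

/-- `θ` is the perspectivity `proj^F_F'`: `F` and `F'` are opposite, and `θ` is the map from the
residue of `F` to that of `F'` induced by the projection of the chambers through `F` onto `F'`. -/
def IsPerspectivity (F F' : Set V) (θ : Δ.Residue F ≃ Δ.Residue F') : Prop :=
  Δ.Opposite F F' ∧ ∀ C C' : {C : Set V // Δ.IsChamber C}, F ⊆ C.1 → Δ.IsProjection F' C C' →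
    ∀ v : Δ.Residue F, v.1 ∈ C.1 ↔ (θ v).1 ∈ C'.1

/-- Projectivities of length `n`: composites of `n` consecutive perspectivities. -/
inductive IsProjectivity : ℕ → (F F' : Set V) → (Δ.Residue F ≃ Δ.Residue F') → Prop
  | refl (F : Set V) : IsProjectivity 0 F F (Equiv.refl _)
  | step (n : ℕ) (F G H : Set V) (θ : Δ.Residue F ≃ Δ.Residue G)
      (η : Δ.Residue G ≃ Δ.Residue H) :
      IsProjectivity n F G θ → Δ.IsPerspectivity G H η → IsProjectivity (n + 1) F H (θ.trans η)

/-- The general projectivity group `Π(F)` of all self-projectivities of `F`, as a permutation group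
of the residue. -/
def generalGroup (F : Set V) : Subgroup (Equiv.Perm (Δ.Residue F)) :=
  Subgroup.closure {θ | ∃ n, Δ.IsProjectivity n F F θ}

/-- The special projectivity group `Π⁺(F)` of all even self-projectivities of `F`. -/
def specialGroup (F : Set V) : Subgroup (Equiv.Perm (Δ.Residue F)) :=
  Subgroup.closure {θ | ∃ n, Even n ∧ Δ.IsProjectivity n F F θ}

/-- The number `n(J) = [Π(F) : Π⁺(F)]`, where `J` is the type of `F`. -/
noncomputable def projIndex (F : Set V) : ℕ := (Δ.specialGroup F).relIndex (Δ.generalGroup F)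

end BuildingA

namespace CoxVertex

variable {m : ℕ}

/-- Comparability of vertices of the Coxeter complex. -/
def Nested (x y : CoxVertex m) : Prop := x.1 ⊆ y.1 ∨ y.1 ⊆ x.1

theorem isSimplex_pair {x y : CoxVertex m} : IsSimplex {x, y} ↔ Nested x y := by
  constructor
  · intro h; exact h x (by simp) y (by simp)
  · rintro h a (rfl | rfl) b (rfl | rfl)
    · exact Or.inl subset_rfl
    · exact h
    · exact h.symm
    · exact Or.inl subset_rfl

theorem IsAut.nested_iff {g : Equiv.Perm (CoxVertex m)} (hg : IsAut g) (x y : CoxVertex m) :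
    Nested (g x) (g y) ↔ Nested x y := by
  rw [← isSimplex_pair, ← isSimplex_pair, ← hg {x, y}, Set.image_pair]

theorem isAut_of_nested {g : Equiv.Perm (CoxVertex m)}
    (hg : ∀ x y, Nested (g x) (g y) ↔ Nested x y) : IsAut g := by
  intro F
  constructor
  · intro h x hx y hy
    exact (hg x y).1 (h _ ⟨x, hx, rfl⟩ _ ⟨y, hy, rfl⟩)
  · rintro h _ ⟨x, hx, rfl⟩ _ ⟨y, hy, rfl⟩
    exact (hg x y).2 (h x hx y hy)

/-- The vertices of `α` that are joined to no vertex outside `α`. -/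
def inner (α : Set (CoxVertex m)) : Set (CoxVertex m) :=
  {x | x ∈ α ∧ ∀ y, y ∉ α → ¬ Nested x y}

/-- The inner vertices of `α` that are joined to all inner vertices. -/
def innerCentre (α : Set (CoxVertex m)) : Set (CoxVertex m) :=
  {x | x ∈ inner α ∧ ∀ z ∈ inner α, Nested x z}

theorem IsAut.mem_iff {α : Set (CoxVertex m)} {g : Equiv.Perm (CoxVertex m)} (h : g '' α = α)
    (x : CoxVertex m) : g x ∈ α ↔ x ∈ α := by
  conv_lhs => rw [← h]
  exact g.injective.mem_set_image

theorem IsAut.mem_inner_iff {α : Set (CoxVertex m)} {g : Equiv.Perm (CoxVertex m)} (hg : IsAut g)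
    (h : g '' α = α) (x : CoxVertex m) : g x ∈ inner α ↔ x ∈ inner α := by
  unfold inner
  simp only [Set.mem_ofPred_eq, IsAut.mem_iff h]
  rw [← g.forall_congr_right]
  simp only [IsAut.mem_iff h, hg.nested_iff]

theorem IsAut.mem_innerCentre_iff {α : Set (CoxVertex m)} {g : Equiv.Perm (CoxVertex m)}
    (hg : IsAut g) (h : g '' α = α) (x : CoxVertex m) :
    g x ∈ innerCentre α ↔ x ∈ innerCentre α := by
  unfold innerCentre
  simp only [Set.mem_ofPred_eq, hg.mem_inner_iff h]
  rw [← g.forall_congr_right]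
  simp only [hg.mem_inner_iff h, hg.nested_iff]

/-- The singleton vertex `{i}`. -/
def single (hm : 1 ≤ m) (i : Fin (m + 1)) : CoxVertex m :=
  ⟨{i}, by simp, fun h => by
    have := congrArg Finset.card h
    simp at this; omega⟩

/-- The complement of a singleton. -/
def cosingle (hm : 1 ≤ m) (j : Fin (m + 1)) : CoxVertex m :=
  ⟨{j}ᶜ, by
    rw [← Finset.card_pos, Finset.card_compl]; simp; omega, by
    intro h
    have := congrArg Finset.card h
    rw [Finset.card_compl] at this; simp at this⟩

theorem mem_root {i j : Fin (m + 1)} {x : CoxVertex m} : x ∈ root i j ↔ (j ∈ x.1 → i ∈ x.1) :=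
  Iff.rfl

theorem inner_root (hm : 1 ≤ m) {i j : Fin (m + 1)} (hij : i ≠ j) :
    inner (root i j) = {x | i ∈ x.1 ∧ j ∉ x.1} := by
  ext x
  constructor
  · rintro ⟨-, h⟩
    constructor
    · by_contra hi
      refine h (cosingle hm i) (by rw [mem_root]; simp [cosingle, hij.symm]) (Or.inl ?_)
      intro t ht
      simp only [cosingle, Finset.mem_compl, Finset.mem_singleton]
      rintro rfl; exact hi ht
    · intro hj
      refine h (single hm j) (by rw [mem_root]; simp [single, hij]) (Or.inr ?_)
      simpa [single] using hj
  · rintro ⟨hi, hj⟩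
    refine ⟨fun _ => hi, fun y hy h => ?_⟩
    simp only [root, Set.mem_ofPred_eq, Classical.not_imp] at hy
    rcases h with h | h
    · exact hy.2 (h hi)
    · exact hj (h hy.1)

theorem innerCentre_root (hm : 1 ≤ m) {i j : Fin (m + 1)} (hij : i ≠ j) :
    innerCentre (root i j) = {single hm i, cosingle hm j} := by
  ext x
  unfold innerCentre
  rw [inner_root hm hij]
  simp only [Set.mem_ofPred_eq, Set.mem_insert_iff, Set.mem_singleton_iff]
  constructor
  · rintro ⟨⟨hi, hj⟩, h⟩
    by_contra! hne
    obtain ⟨t, htj, htx⟩ : ∃ t, t ≠ j ∧ t ∉ x.1 := by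
      by_contra! hall
      refine hne.2 (Subtype.ext ?_)
      ext t
      simp only [cosingle, Finset.mem_compl, Finset.mem_singleton]
      exact ⟨fun ht e => hj (e ▸ ht), fun ht => hall t ht⟩
    obtain ⟨s, hsi, hsx⟩ : ∃ s, s ≠ i ∧ s ∈ x.1 := by
      by_contra! hall
      refine hne.1 (Subtype.ext ?_)
      ext s
      simp only [single, Finset.mem_singleton]
      exact ⟨fun hs => by_contra fun e => hall s e hs, fun e => e ▸ hi⟩
    have hjs : j ≠ s := fun e => hj (e ▸ hsx)
    have hti : t ≠ i := fun e => htx (e ▸ hi)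
    let z : CoxVertex m := ⟨{i, t}, by simp, fun e => by
      have : j ∈ ({i, t} : Finset (Fin (m + 1))) := e ▸ Finset.mem_univ j
      simp [hij.symm, htj.symm] at this⟩
    rcases h z ⟨by simp [z], by simp [z, hij.symm, htj.symm]⟩ with h | h
    · have := h hsx
      simp only [z, Finset.mem_insert, Finset.mem_singleton] at this
      rcases this with e | e
      · exact hsi e
      · exact htx (e ▸ hsx)
    · exact htx (h (by simp [z]))
  · rintro (rfl | rfl)
    · refine ⟨⟨by simp [single], by simp [single, hij.symm]⟩, fun z hz => Or.inl ?_⟩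
      simpa [single] using hz.1
    · refine ⟨⟨by simp [cosingle, hij], by simp [cosingle]⟩, fun z hz => Or.inr ?_⟩
      intro t ht
      simp only [cosingle, Finset.mem_compl, Finset.mem_singleton]
      rintro rfl; exact hz.2 ht

theorem isCentre_root (hm : 1 ≤ m) {i j : Fin (m + 1)} (hij : i ≠ j) :
    IsCentre (root i j) {single hm i, cosingle hm j} := by
  refine ⟨isSimplex_pair.2 (Or.inl ?_), by simp, ?_, fun g hg h => ?_⟩
  · simp [single, cosingle, hij.symm]
  · rintro x (rfl | rfl)
    · rw [mem_root]; simp [single]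
    · rw [mem_root]; simp [cosingle, hij]
  · rw [← innerCentre_root hm hij]
    ext x
    obtain ⟨y, rfl⟩ := g.surjective x
    rw [g.injective.mem_set_image, hg.mem_innerCentre_iff h]

/-- The automorphism induced by a permutation of the ground set. -/
def permAut (σ : Equiv.Perm (Fin (m + 1))) : Equiv.Perm (CoxVertex m) :=
  Equiv.subtypeEquiv (Equiv.finsetCongr σ) (fun A => by
    rw [Equiv.finsetCongr_apply, Finset.map_nonempty, ne_eq, ne_eq,
      ← (Finset.map_injective σ.toEmbedding).eq_iff (b := Finset.univ), Finset.map_univ_equiv])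

theorem mem_permAut (σ : Equiv.Perm (Fin (m + 1))) (x : CoxVertex m) (t : Fin (m + 1)) :
    t ∈ (permAut σ x).1 ↔ σ.symm t ∈ x.1 := by
  change t ∈ Finset.map σ.toEmbedding x.1 ↔ _
  rw [Finset.mem_map_equiv]

/-- The duality mapping each subset to its complement. -/
def complAut : Equiv.Perm (CoxVertex m) :=
  Equiv.subtypeEquiv (compl_involutive.toPerm (compl : Finset (Fin (m + 1)) → _)) (fun A => by
    change A.Nonempty ∧ A ≠ Finset.univ ↔ Aᶜ.Nonempty ∧ Aᶜ ≠ Finset.univ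
    rw [Finset.nonempty_iff_ne_empty, Finset.nonempty_iff_ne_empty, ne_eq, ne_eq, ne_eq, ne_eq,
      Finset.compl_eq_empty_iff, Finset.compl_eq_univ_iff]
    exact and_comm)

theorem mem_complAut (x : CoxVertex m) (t : Fin (m + 1)) :
    t ∈ (complAut x).1 ↔ t ∉ x.1 := by
  change t ∈ x.1ᶜ ↔ _
  simp

theorem isAut_permAut (σ : Equiv.Perm (Fin (m + 1))) : IsAut (permAut σ) := by
  apply isAut_of_nested
  intro x y
  have key : ∀ x y : CoxVertex m, (permAut σ x).1 ⊆ (permAut σ y).1 ↔ x.1 ⊆ y.1 := by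
    intro _ _
    exact Finset.map_subset_map
  unfold Nested
  rw [key, key]

theorem isAut_complAut : IsAut (complAut : Equiv.Perm (CoxVertex m)) := by
  apply isAut_of_nested
  intro x y
  have key : ∀ x y : CoxVertex m, (complAut x).1 ⊆ (complAut y).1 ↔ y.1 ⊆ x.1 := by
    intro _ _
    exact Finset.compl_subset_compl
  unfold Nested
  rw [key, key]
  exact or_comm

theorem IsAut.mul {g h : Equiv.Perm (CoxVertex m)} (hg : IsAut g) (hh : IsAut h) :
    IsAut (g * h) :=
  isAut_of_nested fun _ _ => (hg.nested_iff _ _).trans (hh.nested_iff _ _)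

theorem image_eq_of_mem_iff {α : Set (CoxVertex m)} {g : Equiv.Perm (CoxVertex m)}
    (h : ∀ x, g x ∈ α ↔ x ∈ α) : g '' α = α := by
  ext x
  obtain ⟨y, rfl⟩ := g.surjective x
  rw [g.injective.mem_set_image, h]

theorem eq_of_nested_of_card {x y : CoxVertex m} (h : Nested x y) (hc : x.1.card = y.1.card) :
    x = y := by
  rcases h with h | h
  · exact Subtype.ext (Finset.eq_of_subset_of_card_le h hc.ge)
  · exact (Subtype.ext (Finset.eq_of_subset_of_card_le h hc.le)).symm

theorem isCentre_root_unique (hm : 1 ≤ m) {i j : Fin (m + 1)} (hij : i ≠ j)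
    {F : Set (CoxVertex m)} (hF : IsCentre (root i j) F) :
    F = {single hm i, cosingle hm j} := by
  obtain ⟨hs, hne, hsub, hfix⟩ := hF
  let δ : Equiv.Perm (CoxVertex m) := permAut (Equiv.swap i j) * complAut
  have hδmem : ∀ x t, t ∈ (δ x).1 ↔ Equiv.swap i j t ∉ x.1 := by
    intro x t
    rw [Equiv.Perm.mul_apply, mem_permAut, mem_complAut, Equiv.symm_swap]
  have hδ : ∀ x ∈ F, δ x ∈ F := by
    intro x hx
    rw [← hfix δ ((isAut_permAut _).mul isAut_complAut) (image_eq_of_mem_iff fun x => ?_)]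
    · exact ⟨x, hx, rfl⟩
    · simp only [root, Set.mem_ofPred_eq, hδmem, Equiv.swap_apply_left, Equiv.swap_apply_right]
      tauto
  have hswap : ∀ x ∈ F, ∀ s t, s ≠ i → s ≠ j → t ≠ i → t ≠ j → s ∈ x.1 → t ∈ x.1 := by
    intro x hx s t hsi hsj hti htj hmem
    have h1 : permAut (Equiv.swap s t) x ∈ F := by
      rw [← hfix (permAut (Equiv.swap s t)) (isAut_permAut _) (image_eq_of_mem_iff fun x => ?_)]
      · exact ⟨x, hx, rfl⟩
      · simp only [root, Set.mem_ofPred_eq, mem_permAut, Equiv.symm_swap]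
        rw [Equiv.swap_apply_of_ne_of_ne hsi.symm hti.symm,
          Equiv.swap_apply_of_ne_of_ne hsj.symm htj.symm]
    have h2 : permAut (Equiv.swap s t) x = x :=
      eq_of_nested_of_card (hs _ h1 _ hx) (Finset.card_map _)
    rw [← h2, mem_permAut, Equiv.symm_swap, Equiv.swap_apply_right]
    exact hmem
  have hmem : ∀ x ∈ F, x = single hm i ∨ x = cosingle hm j := by
    intro x hx
    by_cases hc : i ∈ x.1 ∧ j ∉ x.1
    · by_cases hr : ∃ s ∈ x.1, s ≠ i
      · obtain ⟨s, hsx, hsi⟩ := hr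
        right
        refine Subtype.ext (Finset.ext fun t => ?_)
        simp only [cosingle, Finset.mem_compl, Finset.mem_singleton]
        refine ⟨fun ht e => hc.2 (e ▸ ht), fun ht => ?_⟩
        by_cases hti : t = i
        · exact hti ▸ hc.1
        · exact hswap x hx s t hsi (fun e => hc.2 (e ▸ hsx)) hti ht hsx
      · push Not at hr
        left
        refine Subtype.ext (Finset.ext fun t => ?_)
        simp only [single, Finset.mem_singleton]
        exact ⟨hr t, fun e => e ▸ hc.1⟩
    · exfalso
      have hroot : j ∈ x.1 → i ∈ x.1 := hsub hx
      have hcompl : ∀ t, t ∈ (δ x).1 ↔ t ∉ x.1 := by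
        intro t
        rw [hδmem]
        by_cases hti : t = i
        · subst hti; rw [Equiv.swap_apply_left]; tauto
        by_cases htj : t = j
        · subst htj; rw [Equiv.swap_apply_right]; tauto
        rw [Equiv.swap_apply_of_ne_of_ne hti htj]
      rcases hs _ (hδ x hx) x hx with h | h
      · refine x.2.2 (Finset.eq_univ_iff_forall.2 fun t => ?_)
        by_contra ht
        exact ht (h ((hcompl t).2 ht))
      · obtain ⟨t, ht⟩ := x.2.1
        exact (hcompl t).1 (h ht) ht
  have h1 : δ (single hm i) = cosingle hm j := by
    refine Subtype.ext (Finset.ext fun t => ?_)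
    rw [hδmem]
    simp only [single, cosingle, Finset.mem_compl, Finset.mem_singleton]
    rw [Equiv.swap_apply_eq_iff, Equiv.swap_apply_left]
  have h2 : δ (cosingle hm j) = single hm i := by
    refine Subtype.ext (Finset.ext fun t => ?_)
    rw [hδmem]
    simp only [single, cosingle, Finset.mem_compl, Finset.mem_singleton, not_not]
    rw [Equiv.swap_apply_eq_iff, Equiv.swap_apply_right]
  apply Set.Subset.antisymm
  · intro x hx; exact hmem x hx
  · obtain ⟨x, hx⟩ := hne
    have hx' := hδ x hx
    rcases hmem x hx with rfl | rfl
    · rw [h1] at hx'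
      rintro y (rfl | rfl) <;> assumption
    · rw [h2] at hx'
      rintro y (rfl | rfl) <;> assumption

end CoxVertex

open CoxVertex in
theorem isPolarType_iff {m : ℕ} (hm : 1 ≤ m) (T : Set ℕ) : IsPolarType m T ↔ T = {1, m} := by
  have key : ∀ i j : Fin (m + 1), typ '' {single hm i, cosingle hm j} = ({1, m} : Set ℕ) := by
    intro i j
    rw [Set.image_pair]
    simp [typ, single, cosingle, Finset.card_compl]
  constructor
  · rintro ⟨i, j, hij, F, hF, rfl⟩
    rw [isCentre_root_unique hm hij hF, key]
  · rintro rfl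
    have hij : (0 : Fin (m + 1)) ≠ Fin.last m := by
      intro h
      have := congrArg Fin.val h
      simp at this; omega
    exact ⟨_, _, hij, _, isCentre_root hm hij, key _ _⟩

theorem isPolarTypeInResidue_iff {r : ℕ} {K T : Set ℕ} :
    IsPolarTypeInResidue r K T ↔ ∃ a b, IsComponent r K a b ∧ T = {a, b} := by
  have key : ∀ a b, IsComponent r K a b →
      (fun t => t + (a - 1)) '' {1, b - a + 1} = ({a, b} : Set ℕ) := by
    intro a b h
    have ha := (h.2.1 (Set.left_mem_Icc.2 h.1)).1.1
    have hab := h.1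
    rw [Set.image_pair]
    congr 1
    · omega
    · congr 1; omega
  constructor
  · rintro ⟨a, b, h, T₀, hT, rfl⟩
    rw [isPolarType_iff (by omega)] at hT
    exact ⟨a, b, h, by rw [hT, key a b h]⟩
  · rintro ⟨a, b, h, rfl⟩
    exact ⟨a, b, h, _, (isPolarType_iff (by omega) _).2 rfl, (key a b h).symm⟩

/-- The symmetric set of types whose complement is the central interval `{k + 1, …, r - k}`. -/
def outerTypes (r k : ℕ) : Set ℕ := Set.Icc 1 k ∪ Set.Icc (r - k + 1) r

theorem PolarClosed.eq_outerTypes {r : ℕ} {J : Set ℕ} (h : PolarClosed r J) :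
    (∃ k, 2 * k ≤ r ∧ J = outerTypes r k) ∨ J = Set.Icc 1 r := by
  induction h with
  | empty =>
    left
    refine ⟨0, by omega, ?_⟩
    ext t; simp [outerTypes]
  | step J T _ _ _ hT ih =>
    obtain ⟨a, b, ⟨hab, hsub, ha, hb⟩, rfl⟩ := isPolarTypeInResidue_iff.1 hT
    have haI := hsub (Set.left_mem_Icc.2 hab)
    have hbI := hsub (Set.right_mem_Icc.2 hab)
    rcases ih with ⟨k, hk, rfl⟩ | rfl
    · have hall : ∀ t, a ≤ t → t ≤ b → k < t ∧ t ≤ r - k := by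
        intro t h1 h2
        have := hsub ⟨h1, h2⟩
        simp only [outerTypes, Set.mem_sdiff, Set.mem_union, Set.mem_Icc] at this
        omega
      have h1 := hall a le_rfl hab
      have h2 := hall b hab le_rfl
      simp only [outerTypes, Set.mem_sdiff, Set.mem_union, Set.mem_Icc] at ha hb
      have ea : a = k + 1 := by omega
      have eb : b = r - k := by omega
      by_cases hlt : a < b
      · left
        refine ⟨k + 1, by omega, ?_⟩
        ext t
        simp only [outerTypes, Set.mem_union, Set.mem_Icc, Set.mem_insert_iff,
          Set.mem_singleton_iff]
        omega
      · right
        ext t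
        simp only [outerTypes, Set.mem_union, Set.mem_Icc, Set.mem_insert_iff,
          Set.mem_singleton_iff]
        omega
    · exact absurd haI.1 haI.2

theorem polarClosed_outerTypes {r : ℕ} (k : ℕ) (hk : 2 * k ≤ r - 1) :
    PolarClosed r (outerTypes r k) := by
  induction k with
  | zero =>
    have : outerTypes r 0 = ∅ := by ext t; simp [outerTypes]
    rw [this]; exact PolarClosed.empty
  | succ k ih =>
    have e : outerTypes r (k + 1) = outerTypes r k ∪ {k + 1, r - k} := by
      ext t
      simp only [outerTypes, Set.mem_union, Set.mem_Icc, Set.mem_insert_iff,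
        Set.mem_singleton_iff]
      omega
    rw [e]
    refine PolarClosed.step _ _ (ih (by omega)) ?_ (Or.inr (Set.ncard_pair (by omega))) ?_
    · rw [Set.disjoint_left]
      intro t
      simp only [outerTypes, Set.mem_union, Set.mem_Icc, Set.mem_insert_iff,
        Set.mem_singleton_iff]
      omega
    · refine isPolarTypeInResidue_iff.2 ⟨k + 1, r - k, ⟨by omega, ?_, ?_, ?_⟩, rfl⟩
      · intro t
        simp only [outerTypes, Set.mem_sdiff, Set.mem_union, Set.mem_Icc]
        omega
      · simp only [outerTypes, Set.mem_sdiff, Set.mem_union, Set.mem_Icc]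
        omega
      · simp only [outerTypes, Set.mem_sdiff, Set.mem_union, Set.mem_Icc]
        omega

theorem ncard_outerTypes {r k : ℕ} (hk : 2 * k ≤ r) : (outerTypes r k).ncard = 2 * k := by
  have e : outerTypes r k = ↑(Finset.Icc 1 k ∪ Finset.Icc (r - k + 1) r) := by
    simp [outerTypes]
  rw [e, Set.ncard_coe_finset, Finset.card_union_of_disjoint]
  · simp; omega
  · rw [Finset.disjoint_left]
    intro t
    simp only [Finset.mem_Icc]
    omega

theorem polarClosed_iff {r : ℕ} {J : Set ℕ} (hJ : J ⊂ Set.Icc 1 r) :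
    PolarClosed r J ↔ ∃ k : ℕ, 2 * k ≤ r - 1 ∧ J.ncard = 2 * k ∧
      J = Set.Icc 1 k ∪ Set.Icc (r - k + 1) r := by
  constructor
  · intro h
    rcases h.eq_outerTypes with ⟨k, hk, rfl⟩ | rfl
    · refine ⟨k, ?_, ncard_outerTypes hk, rfl⟩
      by_contra hlt
      refine hJ.2 fun t ht => ?_
      simp only [outerTypes, Set.mem_union, Set.mem_Icc] at ht ⊢
      omega
    · exact absurd hJ (lt_irrefl _)
  · rintro ⟨k, hk, -, rfl⟩
    exact polarClosed_outerTypes k hk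

/-! ### Opposite types -/

open CoxVertex in
theorem oppVertex_iff {r : ℕ} {x y : CoxVertex r} : OppVertex x y ↔ y.1 = x.1ᶜ := by
  constructor
  · rintro ⟨hne, h⟩
    have hw : ∀ i j, (i ∈ x.1 ↔ j ∈ x.1) → (i ∈ y.1 ↔ j ∈ y.1) := by
      intro i j hij
      by_cases e : i = j
      · rw [e]
      · have := h i j e ⟨hij.2, hij.1⟩
        exact ⟨this.2, this.1⟩
    obtain ⟨a, ha⟩ := x.2.1
    obtain ⟨b, hb⟩ : ∃ b, b ∉ x.1 := by
      by_contra! hall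
      exact x.2.2 (Finset.eq_univ_iff_forall.2 hall)
    have hin : ∀ t ∈ x.1, (t ∈ y.1 ↔ a ∈ y.1) := fun t ht => hw t a (by simp [ht, ha])
    have hout : ∀ t, t ∉ x.1 → (t ∈ y.1 ↔ b ∈ y.1) := fun t ht => hw t b (by simp [ht, hb])
    by_cases hay : a ∈ y.1 <;> by_cases hby : b ∈ y.1
    · refine absurd (Finset.eq_univ_iff_forall.2 fun t => ?_) y.2.2
      by_cases ht : t ∈ x.1
      · exact (hin t ht).2 hay
      · exact (hout t ht).2 hby
    · refine absurd (Subtype.ext (Finset.ext fun t => ?_)) hne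
      by_cases ht : t ∈ x.1
      · simp [ht, (hin t ht).2 hay]
      · simp [ht, (hout t ht), hby]
    · ext t
      rw [Finset.mem_compl]
      by_cases ht : t ∈ x.1
      · simp [ht, (hin t ht), hay]
      · simp [ht, (hout t ht), hby]
    · obtain ⟨t, ht⟩ := y.2.1
      by_cases h' : t ∈ x.1
      · exact absurd ((hin t h').1 ht) hay
      · exact absurd ((hout t h').1 ht) hby
  · intro h
    constructor
    · rintro rfl
      obtain ⟨a, ha⟩ := x.2.1
      have ha' := ha
      rw [h, Finset.mem_compl] at ha'
      exact ha' ha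
    · rintro i j - ⟨h1, h2⟩
      simp only [root, Set.mem_ofPred_eq] at h1 h2
      refine ⟨?_, ?_⟩ <;> simp only [root, Set.mem_ofPred_eq, h, Finset.mem_compl] <;> tauto

open CoxVertex in
theorem oppTypes_eq {r : ℕ} {J : Set ℕ} (hJ : J ⊆ Set.Icc 1 r) :
    oppTypes r J = {t | t ≤ r ∧ r + 1 - t ∈ J} := by
  ext t
  constructor
  · rintro ⟨x, y, h, hx, rfl⟩
    rw [oppVertex_iff] at h
    have hx' := hJ hx
    have hc : y.typ = r + 1 - x.typ := by
      simp [typ, h, Finset.card_compl]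
    have := hx'.1
    have := hx'.2
    refine ⟨by omega, ?_⟩
    rw [hc]
    convert hx using 1
    omega
  · rintro ⟨ht, hmem⟩
    have := hJ hmem
    simp only [Set.mem_Icc] at this
    obtain ⟨A, -, hA⟩ := Finset.exists_subset_card_eq
      (s := (Finset.univ : Finset (Fin (r + 1)))) (n := r + 1 - t) (by simp)
    have h1 : A.Nonempty ∧ A ≠ Finset.univ := by
      constructor
      · rw [← Finset.card_pos]; omega
      · rintro rfl
        simp at hA; omega
    refine ⟨⟨A, h1⟩, complAut ⟨A, h1⟩, oppVertex_iff.2 rfl, ?_, ?_⟩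
    · simpa [typ, hA] using hmem
    · change Aᶜ.card = t
      rw [Finset.card_compl, hA]; simp; omega

/-! ### The lattice of a building of type `A_r` -/

namespace BuildingA

variable {r : ℕ} {V : Type*}

/-- The vertices of a building of type `A_r`, with a bottom and a top element adjoined. -/
inductive Lat (Δ : BuildingA r V) : Type _
  | bot : Lat Δ
  | vert (v : V) : Lat Δ
  | top : Lat Δ

variable {Δ : BuildingA r V}

namespace Lat

/-- The rank function: the type on vertices. -/
def rk : Lat Δ → ℕ
  | bot => 0
  | vert v => Δ.typ v
  | top => r + 1

/-- The set of vertices underlying an element, which is empty for the bottom and the top. -/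
def verts (x : Lat Δ) : Set V := {v | x = vert v}

theorem mem_verts {x : Lat Δ} {v : V} : v ∈ x.verts ↔ x = vert v := Iff.rfl

@[simp] theorem verts_vert (v : V) : (vert v : Lat Δ).verts = {v} := by
  ext w; rw [mem_verts]; simp [eq_comm]

@[simp] theorem verts_bot : (bot : Lat Δ).verts = ∅ := by
  ext w; rw [mem_verts]; simp

@[simp] theorem verts_top : (top : Lat Δ).verts = ∅ := by
  ext w; rw [mem_verts]; simp

theorem verts_mem (x : Lat Δ) : x.verts ∈ Δ.simplices := by
  cases x with
  | bot => simpa using Δ.empty_mem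
  | top => simpa using Δ.empty_mem
  | vert v => simpa using Δ.singleton_mem v

theorem rk_vert (v : V) : (vert v : Lat Δ).rk = Δ.typ v := rfl

theorem rk_vert_mem (v : V) : 1 ≤ (vert v : Lat Δ).rk ∧ (vert v : Lat Δ).rk ≤ r :=
  Δ.typ_mem v

theorem rk_le (x : Lat Δ) : x.rk ≤ r + 1 := by
  cases x with
  | bot => simp [rk]
  | top => simp [rk]
  | vert v => exact (rk_vert_mem v).2.trans (Nat.le_succ r)

theorem eq_bot_of_rk {x : Lat Δ} (h : x.rk = 0) : x = bot := by
  cases x with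
  | bot => rfl
  | top => simp [rk] at h
  | vert v => have := (rk_vert_mem (Δ := Δ) v).1; omega

theorem eq_top_of_rk {x : Lat Δ} (h : x.rk = r + 1) : x = top := by
  cases x with
  | bot => simp [rk] at h
  | top => rfl
  | vert v => have := (rk_vert_mem (Δ := Δ) v).2; omega

theorem exists_vert_of_rk {x : Lat Δ} (h : 1 ≤ x.rk) (h' : x.rk ≤ r) : ∃ v, x = vert v := by
  cases x with
  | bot => simp [rk] at h
  | top => simp [rk] at h'
  | vert v => exact ⟨v, rfl⟩

instance : LE (Lat Δ) := ⟨fun x y => x.rk ≤ y.rk ∧ x.verts ∪ y.verts ∈ Δ.simplices⟩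

theorem le_def {x y : Lat Δ} : x ≤ y ↔ x.rk ≤ y.rk ∧ x.verts ∪ y.verts ∈ Δ.simplices := Iff.rfl

theorem eq_of_rk_eq_of_mem {x y : Lat Δ} (h : x.rk = y.rk)
    (hs : x.verts ∪ y.verts ∈ Δ.simplices) : x = y := by
  by_cases h0 : x.rk = 0
  · rw [eq_bot_of_rk h0, eq_bot_of_rk (h.symm.trans h0)]
  by_cases h1 : x.rk = r + 1
  · rw [eq_top_of_rk h1, eq_top_of_rk (h.symm.trans h1)]
  have := rk_le x
  obtain ⟨v, rfl⟩ := exists_vert_of_rk (x := x) (by omega) (by omega)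
  obtain ⟨w, rfl⟩ := exists_vert_of_rk (x := y) (by omega) (by omega)
  congr 1
  exact Δ.typ_injOn _ hs (by simp) (by simp) h

end Lat

open BuildingA.Lat CoxVertex

/-- The extension of a chart to all subsets. -/
noncomputable def latChart (Δ : BuildingA r V) (e : CoxVertex r → V)
    (X : Finset (Fin (r + 1))) : Lat Δ :=
  if h : X.Nonempty ∧ X ≠ Finset.univ then vert (e ⟨X, h⟩) else if X = ∅ then bot else top

theorem latChart_coe (e : CoxVertex r → V) (x : CoxVertex r) :
    Δ.latChart e x.1 = vert (e x) := by
  unfold latChart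
  rw [dif_pos x.2]
  rfl

theorem latChart_empty (e : CoxVertex r → V) : Δ.latChart e ∅ = bot := by
  simp [latChart]

theorem latChart_univ (e : CoxVertex r → V) : Δ.latChart e Finset.univ = top := by
  simp [latChart, Finset.univ_nonempty.ne_empty]

theorem finset_cases (X : Finset (Fin (r + 1))) :
    X = ∅ ∨ X = Finset.univ ∨ ∃ x : CoxVertex r, X = x.1 := by
  by_cases h0 : X = ∅
  · exact Or.inl h0
  by_cases h1 : X = Finset.univ
  · exact Or.inr (Or.inl h1)
  · exact Or.inr (Or.inr ⟨⟨X, Finset.nonempty_iff_ne_empty.2 h0, h1⟩, rfl⟩)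

variable {A A' : Set (Set V)} {e e' : CoxVertex r → V}

theorem rk_latChart (he : Δ.IsChart A e) (X : Finset (Fin (r + 1))) :
    (Δ.latChart e X).rk = X.card := by
  rcases finset_cases X with rfl | rfl | ⟨x, rfl⟩
  · rw [latChart_empty]; rfl
  · rw [latChart_univ]; simp [rk]
  · rw [latChart_coe]; exact he.2.1 x

theorem mem_chart_iff (he : Δ.IsChart A e) {F : Set V} :
    F ∈ A ↔ ∃ F₀ : Set (CoxVertex r), IsSimplex F₀ ∧ F = e '' F₀ := by
  conv_lhs => rw [he.2.2]
  exact Iff.rfl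

theorem chart_down_closed (he : Δ.IsChart A e) {F G : Set V} (hF : F ∈ A) (hG : G ⊆ F) :
    G ∈ A := by
  obtain ⟨F₀, h, rfl⟩ := (mem_chart_iff he).1 hF
  refine (mem_chart_iff he).2 ⟨F₀ ∩ e ⁻¹' G, fun x hx y hy => h x hx.1 y hy.1, ?_⟩
  rw [Set.image_inter_preimage]
  exact (Set.inter_eq_right.2 hG).symm

theorem verts_latChart (e : CoxVertex r → V) (X : Finset (Fin (r + 1))) :
    (Δ.latChart e X).verts = e '' {x | x.1 = X} := by
  rcases finset_cases X with rfl | rfl | ⟨x, rfl⟩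
  · rw [latChart_empty, verts_bot, eq_comm, Set.image_eq_empty]
    ext x
    exact iff_of_false (Finset.nonempty_iff_ne_empty.1 x.2.1) id
  · rw [latChart_univ, verts_top, eq_comm, Set.image_eq_empty]
    ext x
    exact iff_of_false x.2.2 id
  · rw [latChart_coe, verts_vert]
    have : {y : CoxVertex r | y.1 = x.1} = {x} := by
      ext y; exact Subtype.ext_iff.symm
    rw [this, Set.image_singleton]

theorem union_verts_mem_iff (he : Δ.IsChart A e) (X Y : Finset (Fin (r + 1))) :
    (Δ.latChart e X).verts ∪ (Δ.latChart e Y).verts ∈ A ↔ X ⊆ Y ∨ Y ⊆ X := by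
  rw [verts_latChart, verts_latChart, ← Set.image_union, mem_chart_iff he]
  constructor
  · rintro ⟨F₀, hF, hE⟩
    have := he.1.image_injective hE
    subst this
    rcases finset_cases X with rfl | rfl | ⟨x, rfl⟩
    · simp
    · simp
    rcases finset_cases Y with rfl | rfl | ⟨y, rfl⟩
    · simp
    · simp
    exact hF x (Or.inl rfl) y (Or.inr rfl)
  · intro h
    refine ⟨_, ?_, rfl⟩
    rintro x (hx | hx) y (hy | hy)
    · exact Or.inl (hx.trans hy.symm).subset
    · rw [show x.1 = X from hx, show y.1 = Y from hy]; exact h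
    · rw [show x.1 = Y from hx, show y.1 = X from hy]; exact h.symm
    · exact Or.inl (hx.trans hy.symm).subset

theorem verts_latChart_mem (he : Δ.IsChart A e) (X : Finset (Fin (r + 1))) :
    (Δ.latChart e X).verts ∈ A := by
  simpa using (union_verts_mem_iff he X X).2 (Or.inl subset_rfl)

theorem exists_latChart_eq (he : Δ.IsChart A e) {x : Lat Δ} (hx : x.verts ∈ A) :
    ∃ X, Δ.latChart e X = x := by
  cases x with
  | bot => exact ⟨∅, latChart_empty e⟩
  | top => exact ⟨_, latChart_univ e⟩
  | vert v =>
    obtain ⟨F₀, h, hv⟩ := (mem_chart_iff he).1 hx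
    rw [verts_vert] at hv
    obtain ⟨x, -, rfl⟩ : v ∈ e '' F₀ := hv ▸ rfl
    exact ⟨x.1, latChart_coe e x⟩

/-- Charts of two apartments which agree on given common elements. -/
theorem exists_charts (hA : A ∈ Δ.apartments) (hA' : A' ∈ Δ.apartments) {x y : Lat Δ}
    (hx : x.verts ∈ A) (hy : y.verts ∈ A) (hx' : x.verts ∈ A') (hy' : y.verts ∈ A') :
    ∃ e e', Δ.IsChart A e ∧ Δ.IsChart A' e' ∧ ∃ X Y, Δ.latChart e X = x ∧ Δ.latChart e Y = y ∧
      Δ.latChart e' X = x ∧ Δ.latChart e' Y = y := by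
  obtain ⟨e, e', he, he', h⟩ := Δ.exists_iso A hA A' hA' _ _ hx hy hx' hy'
  have key : ∀ z : Lat Δ, z.verts ⊆ x.verts ∪ y.verts → z.verts ∈ A →
      ∃ Z, Δ.latChart e Z = z ∧ Δ.latChart e' Z = z := by
    intro z hz hzA
    obtain ⟨Z, hZ⟩ := exists_latChart_eq he hzA
    refine ⟨Z, hZ, ?_⟩
    rcases finset_cases Z with rfl | rfl | ⟨u, rfl⟩
    · rw [← hZ, latChart_empty, latChart_empty]
    · rw [← hZ, latChart_univ, latChart_univ]
    · rw [latChart_coe] at hZ ⊢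
      rw [h u (hz hZ.symm), hZ]
  obtain ⟨X, h1, h2⟩ := key x Set.subset_union_left hx
  obtain ⟨Y, h3, h4⟩ := key y Set.subset_union_right hy
  exact ⟨e, e', he, he', X, Y, h1, h3, h2, h4⟩

theorem union_verts_mem_apartment (hA : A ∈ Δ.apartments) {x y : Lat Δ}
    (hx : x.verts ∈ A) (hy : y.verts ∈ A) (h : x.verts ∪ y.verts ∈ Δ.simplices) :
    x.verts ∪ y.verts ∈ A := by
  obtain ⟨A', hA', hm, -⟩ := Δ.exists_apartment _ h _ h
  obtain ⟨e₀, he₀⟩ := Δ.exists_chart A' hA'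
  obtain ⟨e, e', he, he', X, Y, rfl, rfl, h3, h4⟩ := exists_charts hA hA' hx hy
    (chart_down_closed he₀ hm Set.subset_union_left)
    (chart_down_closed he₀ hm Set.subset_union_right)
  rw [union_verts_mem_iff he, ← union_verts_mem_iff he', h3, h4]
  exact hm

theorem latChart_le_iff (hA : A ∈ Δ.apartments) (he : Δ.IsChart A e)
    {X Y : Finset (Fin (r + 1))} : Δ.latChart e X ≤ Δ.latChart e Y ↔ X ⊆ Y := by
  rw [le_def, rk_latChart he, rk_latChart he]
  constructor
  · rintro ⟨hc, h⟩
    have := union_verts_mem_apartment hA (verts_latChart_mem he X) (verts_latChart_mem he Y) h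
    rcases (union_verts_mem_iff he X Y).1 this with h | h
    · exact h
    · exact (Finset.eq_of_subset_of_card_le h hc).ge
  · intro h
    exact ⟨Finset.card_le_card h,
      Δ.apartment_subset A hA ((union_verts_mem_iff he X Y).2 (Or.inl h))⟩

theorem latChart_injective (hA : A ∈ Δ.apartments) (he : Δ.IsChart A e) :
    Function.Injective (Δ.latChart e) := by
  intro X Y h
  have h1 := (latChart_le_iff hA he (X := X) (Y := X)).2 subset_rfl
  have h2 : Δ.latChart e X ≤ Δ.latChart e Y := by rw [← h]; exact h1
  have h3 : Δ.latChart e Y ≤ Δ.latChart e X := by rw [← h]; exact h1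
  exact subset_antisymm ((latChart_le_iff hA he).1 h2) ((latChart_le_iff hA he).1 h3)

/-- A common chart for two simplices. -/
theorem exists_common_chart {F G : Set V} (hF : F ∈ Δ.simplices) (hG : G ∈ Δ.simplices) :
    ∃ A ∈ Δ.apartments, ∃ e, Δ.IsChart A e ∧ F ∈ A ∧ G ∈ A ∧
      ∀ x : Lat Δ, x.verts ⊆ F ∨ x.verts ⊆ G → ∃ X, Δ.latChart e X = x := by
  obtain ⟨A, hA, h1, h2⟩ := Δ.exists_apartment F hF G hG
  obtain ⟨e, he⟩ := Δ.exists_chart A hA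
  refine ⟨A, hA, e, he, h1, h2, fun x hx => exists_latChart_eq he ?_⟩
  rcases hx with hx | hx
  · exact chart_down_closed he h1 hx
  · exact chart_down_closed he h2 hx

theorem card_inter_le_of_charts (hA : A ∈ Δ.apartments) (he : Δ.IsChart A e)
    (he' : Δ.IsChart A e') {X Y X' Y' : Finset (Fin (r + 1))}
    (hX : Δ.latChart e X = Δ.latChart e' X') (hY : Δ.latChart e Y = Δ.latChart e' Y') :
    (X ∩ Y).card ≤ (X' ∩ Y').card := by
  obtain ⟨Z, hZ⟩ := exists_latChart_eq he' (verts_latChart_mem he (X ∩ Y))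
  rw [← rk_latChart he, ← hZ, rk_latChart he']
  apply Finset.card_le_card
  apply Finset.subset_inter
  · rw [← latChart_le_iff hA he', hZ, ← hX, latChart_le_iff hA he]
    exact Finset.inter_subset_left
  · rw [← latChart_le_iff hA he', hZ, ← hY, latChart_le_iff hA he]
    exact Finset.inter_subset_right

theorem card_inter_eq_of_charts (hA : A ∈ Δ.apartments) (he : Δ.IsChart A e)
    (hA' : A' ∈ Δ.apartments) (he' : Δ.IsChart A' e') {X Y X' Y' : Finset (Fin (r + 1))}
    (hX : Δ.latChart e X = Δ.latChart e' X') (hY : Δ.latChart e Y = Δ.latChart e' Y') :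
    (X ∩ Y).card = (X' ∩ Y').card := by
  obtain ⟨e₁, e₂, h1, h2, X₁, Y₁, hX₁, hY₁, hX₂, hY₂⟩ := exists_charts hA hA'
    (verts_latChart_mem he X) (verts_latChart_mem he Y)
    (hX ▸ verts_latChart_mem he' X') (hY ▸ verts_latChart_mem he' Y')
  rw [hX] at hX₂
  rw [hY] at hY₂
  exact (le_antisymm (card_inter_le_of_charts hA he h1 hX₁.symm hY₁.symm)
    (card_inter_le_of_charts hA h1 he hX₁ hY₁)).trans
    (le_antisymm (card_inter_le_of_charts hA' h2 he' hX₂ hY₂)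
    (card_inter_le_of_charts hA' he' h2 hX₂.symm hY₂.symm))

namespace Lat

instance : PartialOrder (Lat Δ) where
  le_refl x := ⟨le_rfl, by rw [Set.union_self]; exact verts_mem x⟩
  le_trans x y z hxy hyz := by
    obtain ⟨A, hA, e, he, -, -, h⟩ := exists_common_chart hxy.2 hyz.2
    obtain ⟨X, rfl⟩ := h x (Or.inl Set.subset_union_left)
    obtain ⟨Y, rfl⟩ := h y (Or.inl Set.subset_union_right)
    obtain ⟨Z, rfl⟩ := h z (Or.inr Set.subset_union_right)
    rw [latChart_le_iff hA he] at *
    exact hxy.trans hyz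
  le_antisymm x y hxy hyx := eq_of_rk_eq_of_mem (le_antisymm hxy.1 hyx.1) hxy.2

instance : BoundedOrder (Lat Δ) where
  bot := bot
  top := top
  bot_le x := ⟨Nat.zero_le _, by rw [verts_bot, Set.empty_union]; exact verts_mem x⟩
  le_top x := ⟨rk_le x, by rw [verts_top, Set.union_empty]; exact verts_mem x⟩

theorem bot_eq : (⊥ : Lat Δ) = bot := rfl

theorem top_eq : (⊤ : Lat Δ) = top := rfl

@[simp] theorem rk_bot : (⊥ : Lat Δ).rk = 0 := rfl

@[simp] theorem rk_top : (⊤ : Lat Δ).rk = r + 1 := rfl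

theorem rk_mono {x y : Lat Δ} (h : x ≤ y) : x.rk ≤ y.rk := h.1

theorem eq_of_le_of_rk_le {x y : Lat Δ} (h : x ≤ y) (hr : y.rk ≤ x.rk) : x = y :=
  eq_of_rk_eq_of_mem (le_antisymm h.1 hr) h.2

theorem rk_lt {x y : Lat Δ} (h : x < y) : x.rk < y.rk := by
  by_contra hn
  exact h.ne (eq_of_le_of_rk_le h.le (not_lt.1 hn))

/-- Four elements forming two pairs of comparable elements lie in a common chart. -/
theorem exists_chart_four {x y z w : Lat Δ} (h : x ≤ y) (h' : z ≤ w) :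
    ∃ A ∈ Δ.apartments, ∃ e, Δ.IsChart A e ∧ ∃ X Y Z W, Δ.latChart e X = x ∧
      Δ.latChart e Y = y ∧ Δ.latChart e Z = z ∧ Δ.latChart e W = w := by
  obtain ⟨A, hA, e, he, -, -, H⟩ := exists_common_chart h.2 h'.2
  obtain ⟨X, hX⟩ := H x (Or.inl Set.subset_union_left)
  obtain ⟨Y, hY⟩ := H y (Or.inl Set.subset_union_right)
  obtain ⟨Z, hZ⟩ := H z (Or.inr Set.subset_union_left)
  obtain ⟨W, hW⟩ := H w (Or.inr Set.subset_union_right)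
  exact ⟨A, hA, e, he, X, Y, Z, W, hX, hY, hZ, hW⟩

theorem isGLB_latChart (hA : A ∈ Δ.apartments) (he : Δ.IsChart A e)
    (X Y : Finset (Fin (r + 1))) :
    IsGLB {Δ.latChart e X, Δ.latChart e Y} (Δ.latChart e (X ∩ Y)) := by
  have h1 := (latChart_le_iff hA he).2 (Finset.inter_subset_left (s₁ := X) (s₂ := Y))
  have h2 := (latChart_le_iff hA he).2 (Finset.inter_subset_right (s₁ := X) (s₂ := Y))
  constructor
  · rintro z (rfl | rfl) <;> assumption
  · intro z hz
    have hzx : z ≤ Δ.latChart e X := hz (Or.inl rfl)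
    have hzy : z ≤ Δ.latChart e Y := hz (Or.inr rfl)
    obtain ⟨A', hA', e', he', Z, X', M, Y', hZ, hX, hM, hY⟩ := exists_chart_four hzx h2
    rw [← hZ] at hzx hzy ⊢
    rw [← hX] at hzx h1
    rw [← hY] at hzy h2
    rw [← hM] at h1 h2 ⊢
    rw [latChart_le_iff hA' he'] at *
    have hc := card_inter_eq_of_charts hA' he' hA he hX hY
    rw [← rk_latChart he (X ∩ Y), ← hM, rk_latChart he'] at hc
    rw [Finset.eq_of_subset_of_card_le (Finset.subset_inter h1 h2) hc.le]
    exact Finset.subset_inter hzx hzy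

theorem isLUB_latChart (hA : A ∈ Δ.apartments) (he : Δ.IsChart A e)
    (X Y : Finset (Fin (r + 1))) :
    IsLUB {Δ.latChart e X, Δ.latChart e Y} (Δ.latChart e (X ∪ Y)) := by
  have h1 := (latChart_le_iff hA he).2 (Finset.subset_union_left (s₁ := X) (s₂ := Y))
  have h2 := (latChart_le_iff hA he).2 (Finset.subset_union_right (s₁ := X) (s₂ := Y))
  constructor
  · rintro z (rfl | rfl) <;> assumption
  · intro z hz
    have hzx : Δ.latChart e X ≤ z := hz (Or.inl rfl)
    have hzy : Δ.latChart e Y ≤ z := hz (Or.inr rfl)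
    obtain ⟨A', hA', e', he', X', Z, Y', M, hX, hZ, hY, hM⟩ := exists_chart_four hzx h2
    have hc := card_inter_eq_of_charts hA' he' hA he hX hY
    have hcx := congrArg rk hX
    have hcy := congrArg rk hY
    have hcm := congrArg rk hM
    rw [rk_latChart he, rk_latChart he'] at hcx hcy hcm
    rw [← hZ] at hzx hzy ⊢
    rw [← hX] at hzx h1
    rw [← hY] at hzy h2
    rw [← hM] at h1 h2 ⊢
    rw [latChart_le_iff hA' he'] at *
    have e1 := Finset.card_union_add_card_inter X Y
    have e2 := Finset.card_union_add_card_inter X' Y'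
    rw [← Finset.eq_of_subset_of_card_le (Finset.union_subset h1 h2) (by omega)]
    exact Finset.union_subset hzx hzy

theorem exists_isGLB (x y : Lat Δ) : ∃ m, IsGLB {x, y} m := by
  obtain ⟨A, hA, e, he, X, _, Y, _, rfl, -, rfl, -⟩ := exists_chart_four (le_refl x) (le_refl y)
  exact ⟨_, isGLB_latChart hA he X Y⟩

theorem exists_isLUB (x y : Lat Δ) : ∃ m, IsLUB {x, y} m := by
  obtain ⟨A, hA, e, he, X, _, Y, _, rfl, -, rfl, -⟩ := exists_chart_four (le_refl x) (le_refl y)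
  exact ⟨_, isLUB_latChart hA he X Y⟩

noncomputable instance : Lattice (Lat Δ) where
  inf x y := (exists_isGLB x y).choose
  sup x y := (exists_isLUB x y).choose
  le_sup_left x y := (exists_isLUB x y).choose_spec.1 (Or.inl rfl)
  le_sup_right x y := (exists_isLUB x y).choose_spec.1 (Or.inr rfl)
  sup_le x y z hx hy := (exists_isLUB x y).choose_spec.2 (by rintro _ (rfl | rfl) <;> assumption)
  inf_le_left x y := (exists_isGLB x y).choose_spec.1 (Or.inl rfl)
  inf_le_right x y := (exists_isGLB x y).choose_spec.1 (Or.inr rfl)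
  le_inf x y z hx hy := (exists_isGLB y z).choose_spec.2 (by rintro _ (rfl | rfl) <;> assumption)

theorem latChart_inf (hA : A ∈ Δ.apartments) (he : Δ.IsChart A e)
    (X Y : Finset (Fin (r + 1))) :
    Δ.latChart e (X ∩ Y) = Δ.latChart e X ⊓ Δ.latChart e Y :=
  (isGLB_latChart hA he X Y).unique isGLB_pair

theorem latChart_sup (hA : A ∈ Δ.apartments) (he : Δ.IsChart A e)
    (X Y : Finset (Fin (r + 1))) :
    Δ.latChart e (X ∪ Y) = Δ.latChart e X ⊔ Δ.latChart e Y :=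
  (isLUB_latChart hA he X Y).unique isLUB_pair

theorem rk_sup_add_rk_inf (x y : Lat Δ) : (x ⊔ y).rk + (x ⊓ y).rk = x.rk + y.rk := by
  obtain ⟨A, hA, e, he, X, _, Y, _, rfl, -, rfl, -⟩ := exists_chart_four (le_refl x) (le_refl y)
  rw [← latChart_inf hA he, ← latChart_sup hA he, rk_latChart he, rk_latChart he, rk_latChart he,
    rk_latChart he, Finset.card_union_add_card_inter]

instance : IsModularLattice (Lat Δ) where
  sup_inf_le_assoc_of_le {x} y {z} hxz := by
    have hle : x ⊔ y ⊓ z ≤ (x ⊔ y) ⊓ z :=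
      sup_le (le_inf le_sup_left hxz) (inf_le_inf_right z le_sup_right)
    refine (eq_of_le_of_rk_le hle ?_).ge
    have h1 := rk_sup_add_rk_inf (x ⊔ y) z
    have h2 := rk_sup_add_rk_inf x (y ⊓ z)
    have h3 := rk_sup_add_rk_inf x y
    have h4 := rk_sup_add_rk_inf y z
    have e1 : x ⊔ y ⊔ z = y ⊔ z := by
      rw [sup_right_comm, sup_eq_right.2 hxz, sup_comm]
    have e2 : x ⊓ (y ⊓ z) = x ⊓ y := by
      rw [inf_comm y, ← inf_assoc, inf_eq_left.2 hxz]
    rw [e1] at h1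
    rw [e2] at h2
    omega

theorem eq_bot_of_rk_eq_zero {x : Lat Δ} (h : x.rk = 0) : x = ⊥ := eq_bot_of_rk h

theorem eq_top_of_rk_eq {x : Lat Δ} (h : x.rk = r + 1) : x = ⊤ := eq_top_of_rk h

end Lat

end BuildingA

/-! ### Flags and chambers -/

/-- `a < b` are consecutive elements of `J ∪ {0, n}`. -/
def IsGap (n : ℕ) (J : Set ℕ) (a b : ℕ) : Prop :=
  a < b ∧ b ≤ n ∧ (a = 0 ∨ a ∈ J) ∧ (b = n ∨ b ∈ J) ∧ ∀ s ∈ J, s ≤ a ∨ b ≤ s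

theorem exists_isGap {n : ℕ} {J : Set ℕ} {t : ℕ} (ht : t ∉ J)
    (h0 : 0 < t) (hn : t < n) : ∃ a b, IsGap n J a b ∧ a < t ∧ t < b := by
  classical
  have hex : ∃ s, t < s ∧ (s = n ∨ s ∈ J) := ⟨n, hn, Or.inl rfl⟩
  obtain ⟨hb1, hb2⟩ := Nat.find_spec hex
  have hb3 : ∀ s, t < s → s ∈ J → Nat.find hex ≤ s := fun s h1 h2 =>
    Nat.find_min' hex ⟨h1, Or.inr h2⟩
  have hb4 : Nat.find hex ≤ n := Nat.find_min' hex ⟨hn, Or.inl rfl⟩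
  generalize Nat.find hex = b at *
  have ha1 : Nat.findGreatest (· ∈ J) t ≤ t := Nat.findGreatest_le t
  have ha2 : Nat.findGreatest (· ∈ J) t ≠ 0 → Nat.findGreatest (· ∈ J) t ∈ J := fun h =>
    Nat.findGreatest_of_ne_zero (P := (· ∈ J)) rfl h
  have ha3 : ∀ s, s ≤ t → s ∈ J → s ≤ Nat.findGreatest (· ∈ J) t := fun s h1 h2 =>
    Nat.le_findGreatest h1 h2
  generalize Nat.findGreatest (· ∈ J) t = a at *
  have hat : a < t := by
    rcases eq_or_ne a 0 with rfl | h
    · exact h0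
    · refine lt_of_le_of_ne ha1 ?_
      rintro rfl
      exact ht (ha2 h)
  refine ⟨a, b, ⟨by omega, hb4, ?_, hb2, fun s hs => ?_⟩, hat, hb1⟩
  · rcases eq_or_ne a 0 with h | h
    · exact Or.inl h
    · exact Or.inr (ha2 h)
  · by_cases h : s ≤ t
    · exact Or.inl (ha3 s h hs)
    · exact Or.inr (hb3 s (not_le.1 h) hs)

namespace BuildingA

open BuildingA.Lat

variable {r : ℕ} {V : Type*} {Δ : BuildingA r V}

variable (Δ) in
/-- The elements of the lattice given by a set of vertices, including bottom and top. -/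
def hat (F : Set V) : Set (Lat Δ) := {x | x.verts ⊆ F}

theorem mem_hat {F : Set V} {x : Lat Δ} : x ∈ Δ.hat F ↔ x.verts ⊆ F := Iff.rfl

theorem vert_mem_hat {F : Set V} {v : V} : vert v ∈ Δ.hat F ↔ v ∈ F := by
  rw [mem_hat, verts_vert, Set.singleton_subset_iff]

theorem bot_mem_hat (F : Set V) : ⊥ ∈ Δ.hat F := by
  rw [mem_hat, bot_eq, verts_bot]; exact Set.empty_subset F

theorem top_mem_hat (F : Set V) : ⊤ ∈ Δ.hat F := by
  rw [mem_hat, top_eq, verts_top]; exact Set.empty_subset F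

theorem hat_mono {F G : Set V} (h : F ⊆ G) : Δ.hat F ⊆ Δ.hat G := fun _ hx => hx.trans h

theorem le_of_rk_le {F : Set V} (hF : F ∈ Δ.simplices) {x y : Lat Δ} (hx : x ∈ Δ.hat F)
    (hy : y ∈ Δ.hat F) (h : x.rk ≤ y.rk) : x ≤ y :=
  ⟨h, Δ.down_closed F hF _ (Set.union_subset hx hy)⟩

theorem eq_of_rk_eq {F : Set V} (hF : F ∈ Δ.simplices) {x y : Lat Δ} (hx : x ∈ Δ.hat F)
    (hy : y ∈ Δ.hat F) (h : x.rk = y.rk) : x = y :=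
  le_antisymm (le_of_rk_le hF hx hy h.le) (le_of_rk_le hF hy hx h.ge)

theorem rk_mem_of_mem_hat {F : Set V} {x : Lat Δ} (hx : x ∈ Δ.hat F) :
    x.rk = 0 ∨ x.rk = r + 1 ∨ x.rk ∈ Δ.typ '' F := by
  cases x with
  | bot => exact Or.inl rfl
  | top => exact Or.inr (Or.inl rfl)
  | vert v => exact Or.inr (Or.inr ⟨v, vert_mem_hat.1 hx, rfl⟩)

theorem exists_mem_hat_of_mem {F : Set V} {t : ℕ} (ht : t = 0 ∨ t = r + 1 ∨ t ∈ Δ.typ '' F) :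
    ∃ x ∈ Δ.hat F, x.rk = t := by
  rcases ht with rfl | rfl | ⟨v, hv, rfl⟩
  · exact ⟨⊥, bot_mem_hat F, rfl⟩
  · exact ⟨⊤, top_mem_hat F, rfl⟩
  · exact ⟨vert v, vert_mem_hat.2 hv, rfl⟩

/-- `x < y` are consecutive elements of the flag `F`, extended by bottom and top. -/
structure IsFlagGap (F : Set V) (x y : Lat Δ) : Prop where
  left_mem : x ∈ Δ.hat F
  right_mem : y ∈ Δ.hat F
  lt : x < y
  le_or_le : ∀ z ∈ Δ.hat F, z ≤ x ∨ y ≤ z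

theorem exists_isFlagGap {F : Set V} (hF : F ∈ Δ.simplices) {a b : ℕ}
    (h : IsGap (r + 1) (Δ.typ '' F) a b) :
    ∃ x y : Lat Δ, IsFlagGap F x y ∧ x.rk = a ∧ y.rk = b := by
  obtain ⟨hab, hbn, ha, hb, hg⟩ := h
  obtain ⟨x, hx, rfl⟩ := exists_mem_hat_of_mem (Δ := Δ) (F := F) (t := a) (by tauto)
  obtain ⟨y, hy, rfl⟩ := exists_mem_hat_of_mem (Δ := Δ) (F := F) (t := b) (by tauto)
  refine ⟨x, y, ⟨hx, hy, ?_, fun z hz => ?_⟩, rfl, rfl⟩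
  · refine lt_of_le_of_ne (le_of_rk_le hF hx hy hab.le) ?_
    rintro rfl
    exact lt_irrefl _ hab
  · have : z.rk ≤ x.rk ∨ y.rk ≤ z.rk := by
      rcases rk_mem_of_mem_hat hz with h | h | h
      · exact Or.inl (h ▸ Nat.zero_le _)
      · exact Or.inr (h ▸ hbn)
      · exact hg _ h
    exact this.imp (le_of_rk_le hF hz hx) (le_of_rk_le hF hy hz)

theorem mem_simplices_of_chart {A : Set (Set V)} {e : CoxVertex r → V} (hA : A ∈ Δ.apartments)
    (he : Δ.IsChart A e) {S : Set V} (hS : ∀ v ∈ S, ∃ X, Δ.latChart e X = vert v)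
    (hc : ∀ v ∈ S, ∀ w ∈ S, (vert v : Lat Δ) ≤ vert w ∨ (vert w : Lat Δ) ≤ vert v) :
    S ∈ Δ.simplices := by
  have key : ∀ v ∈ S, ∃ x, e x = v := by
    intro v hv
    obtain ⟨X, hX⟩ := hS v hv
    rcases finset_cases X with rfl | rfl | ⟨x, rfl⟩
    · rw [latChart_empty] at hX; cases hX
    · rw [latChart_univ] at hX; cases hX
    · rw [latChart_coe] at hX
      exact ⟨x, by injection hX⟩
  refine Δ.apartment_subset A hA ((mem_chart_iff he).2 ⟨e ⁻¹' S, ?_, ?_⟩)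
  · intro x hx y hy
    have := hc _ hx _ hy
    rwa [← latChart_coe, ← latChart_coe, latChart_le_iff hA he, latChart_le_iff hA he] at this
  · rw [Set.image_preimage_eq_inter_range, eq_comm, Set.inter_eq_left]
    exact key

theorem comparable_of_mem {F : Set V} (hF : F ∈ Δ.simplices) {v w : V} (hv : v ∈ F)
    (hw : w ∈ F) : (vert v : Lat Δ) ≤ vert w ∨ (vert w : Lat Δ) ≤ vert v := by
  rcases le_total (vert v : Lat Δ).rk (vert w : Lat Δ).rk with h | h
  · exact Or.inl (le_of_rk_le hF (vert_mem_hat.2 hv) (vert_mem_hat.2 hw) h)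
  · exact Or.inr (le_of_rk_le hF (vert_mem_hat.2 hw) (vert_mem_hat.2 hv) h)

theorem insert_mem_simplices {F : Set V} (hF : F ∈ Δ.simplices) {v : V}
    (h : ∀ w ∈ F, (vert v : Lat Δ) ≤ vert w ∨ (vert w : Lat Δ) ≤ vert v) :
    insert v F ∈ Δ.simplices := by
  obtain ⟨A, hA, e, he, -, -, H⟩ := exists_common_chart hF (Δ.singleton_mem v)
  refine mem_simplices_of_chart hA he ?_ ?_
  · rintro w (rfl | hw)
    · exact H _ (Or.inr (by simp))
    · exact H _ (Or.inl (by simpa using hw))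
  · rintro w (rfl | hw) u (rfl | hu)
    · exact Or.inl le_rfl
    · exact h u hu
    · exact (h w hw).symm
    · exact comparable_of_mem hF hw hu

theorem insert_mem_of_isFlagGap {F : Set V} (hF : F ∈ Δ.simplices) {x y : Lat Δ}
    (h : IsFlagGap F x y) {v : V} (hx : x ≤ vert v) (hy : vert v ≤ y) :
    insert v F ∈ Δ.simplices := by
  refine insert_mem_simplices hF fun w hw => ?_
  rcases h.le_or_le _ (vert_mem_hat.2 hw) with h | h
  · exact Or.inr (h.trans hx)
  · exact Or.inl (hy.trans h)

theorem monotone_mem_simplices {c : ℕ → Lat Δ} (hc : Monotone c) (m : ℕ) :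
    {v | ∃ i ≤ m, c i = vert v} ∈ Δ.simplices := by
  induction m with
  | zero =>
    refine Δ.down_closed _ (verts_mem (c 0)) _ ?_
    rintro v ⟨i, hi, h⟩
    obtain rfl : i = 0 := by omega
    exact h
  | succ m ih =>
    obtain ⟨A, hA, e, he, -, -, H⟩ := exists_common_chart ih (verts_mem (c (m + 1)))
    refine mem_simplices_of_chart hA he ?_ ?_
    · rintro v ⟨i, hi, h⟩
      apply H
      rw [verts_vert, Set.singleton_subset_iff, Set.singleton_subset_iff]
      rcases Nat.lt_or_ge m i with h' | h'
      · obtain rfl : i = m + 1 := by omega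
        exact Or.inr h
      · exact Or.inl ⟨i, h', h⟩
    · rintro v ⟨i, -, hv⟩ w ⟨j, -, hw⟩
      rw [← hv, ← hw]
      exact (le_total i j).imp (fun h => hc h) (fun h => hc h)

theorem exists_insert {F : Set V} (hF : F ∈ Δ.simplices) {t : ℕ} (ht : t ∈ Set.Icc 1 r)
    (htF : t ∉ Δ.typ '' F) : ∃ v, Δ.typ v = t ∧ insert v F ∈ Δ.simplices := by
  have ht' : 1 ≤ t ∧ t ≤ r := ht
  obtain ⟨a, b, hg, hat, htb⟩ := exists_isGap htF (n := r + 1) (by omega) (by omega)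
  obtain ⟨x, y, hxy, rfl, rfl⟩ := exists_isFlagGap hF hg
  obtain ⟨A, hA, e, he, X, Y, _, _, rfl, rfl, -, -⟩ := exists_chart_four hxy.lt.le hxy.lt.le
  have hs := (latChart_le_iff hA he).1 hxy.lt.le
  rw [rk_latChart he] at hat htb
  obtain ⟨W, h1, h2, h3⟩ := Finset.exists_subsuperset_card_eq hs hat.le htb.le
  have hrk := rk_latChart he W
  obtain ⟨v, hv⟩ := exists_vert_of_rk (x := Δ.latChart e W) (by omega) (by omega)
  rw [hv, h3] at hrk
  refine ⟨v, hrk, insert_mem_of_isFlagGap hF hxy ?_ ?_⟩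
  · rw [← hv, latChart_le_iff hA he]; exact h1
  · rw [← hv, latChart_le_iff hA he]; exact h2

variable (Δ) in
/-- The chambers of a building. -/
abbrev Chamber : Type _ := {C : Set V // Δ.IsChamber C}

theorem exists_chamber {F : Set V} (hF : F ∈ Δ.simplices) : ∃ C : Δ.Chamber, F ⊆ C.1 := by
  have key : ∀ m ≤ r, ∃ G ∈ Δ.simplices, F ⊆ G ∧ Set.Icc 1 m ⊆ Δ.typ '' G := by
    intro m
    induction m with
    | zero => intro _; exact ⟨F, hF, subset_rfl, by simp⟩
    | succ m ih =>
      intro hm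
      obtain ⟨G, hG, hFG, hGm⟩ := ih (by omega)
      have hstep : ∀ G' : Set V, G ⊆ G' → m + 1 ∈ Δ.typ '' G' →
          Set.Icc 1 (m + 1) ⊆ Δ.typ '' G' := by
        intro G' hGG' hmem s hs
        rcases Nat.lt_or_ge m s with h | h
        · obtain rfl : s = m + 1 := le_antisymm hs.2 h
          exact hmem
        · exact Set.image_mono hGG' (hGm ⟨hs.1, h⟩)
      by_cases hmem : m + 1 ∈ Δ.typ '' G
      · exact ⟨G, hG, hFG, hstep G subset_rfl hmem⟩
      · obtain ⟨v, hv, hins⟩ := exists_insert hG ⟨by omega, hm⟩ hmem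
        exact ⟨_, hins, hFG.trans (Set.subset_insert v G),
          hstep _ (Set.subset_insert v G) ⟨v, Set.mem_insert v G, hv⟩⟩
  obtain ⟨G, hG, hFG, hGr⟩ := key r le_rfl
  refine ⟨⟨G, hG, subset_antisymm ?_ hGr⟩, hFG⟩
  rintro _ ⟨v, -, rfl⟩
  exact Δ.typ_mem v

namespace Chamber

theorem mem_simplices (C : Δ.Chamber) : C.1 ∈ Δ.simplices := C.2.1

theorem exists_mem_hat (C : Δ.Chamber) {i : ℕ} (hi : i ≤ r + 1) : ∃ x ∈ Δ.hat C.1, x.rk = i := by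
  apply exists_mem_hat_of_mem
  by_cases h0 : i = 0
  · exact Or.inl h0
  by_cases h1 : i = r + 1
  · exact Or.inr (Or.inl h1)
  · right; right
    rw [C.2.2]
    exact ⟨by omega, by omega⟩

open Classical in
/-- The maximal flag given by a chamber, indexed by rank. -/
noncomputable def flag (C : Δ.Chamber) (i : ℕ) : Lat Δ :=
  if h : i ≤ r + 1 then (C.exists_mem_hat h).choose else ⊤

theorem flag_mem (C : Δ.Chamber) (i : ℕ) : C.flag i ∈ Δ.hat C.1 := by
  unfold flag
  split_ifs with h
  · exact (C.exists_mem_hat h).choose_spec.1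
  · exact top_mem_hat _

theorem rk_flag (C : Δ.Chamber) {i : ℕ} (h : i ≤ r + 1) : (C.flag i).rk = i := by
  unfold flag
  rw [dif_pos h]
  exact (C.exists_mem_hat h).choose_spec.2

theorem flag_eq (C : Δ.Chamber) {x : Lat Δ} (hx : x ∈ Δ.hat C.1) : C.flag x.rk = x :=
  eq_of_rk_eq C.mem_simplices (C.flag_mem _) hx (C.rk_flag (rk_le x))

theorem flag_zero (C : Δ.Chamber) : C.flag 0 = ⊥ := eq_bot_of_rk_eq_zero (C.rk_flag (by omega))

theorem flag_top (C : Δ.Chamber) {i : ℕ} (hi : r + 1 ≤ i) : C.flag i = ⊤ := by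
  rcases hi.eq_or_lt with rfl | h
  · exact eq_top_of_rk_eq (C.rk_flag le_rfl)
  · exact dif_neg (by omega)

theorem flag_mono (C : Δ.Chamber) : Monotone C.flag := by
  intro i j hij
  rcases le_or_gt (r + 1) j with h | h
  · rw [C.flag_top h]; exact le_top
  · apply le_of_rk_le C.mem_simplices (C.flag_mem _) (C.flag_mem _)
    rwa [C.rk_flag (by omega), C.rk_flag h.le]

theorem mem_iff_flag (C : Δ.Chamber) {v : V} : v ∈ C.1 ↔ C.flag (Δ.typ v) = vert v := by
  constructor
  · intro h
    exact C.flag_eq (vert_mem_hat.2 h)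
  · intro h
    rw [← vert_mem_hat (Δ := Δ), ← h]
    exact C.flag_mem _

theorem ext_flag {C D : Δ.Chamber} (h : ∀ i, 1 ≤ i → i ≤ r → C.flag i = D.flag i) : C = D := by
  apply Subtype.ext
  ext v
  rw [mem_iff_flag, mem_iff_flag, h _ (Δ.typ_mem v).1 (Δ.typ_mem v).2]

/-- The chamber of a maximal flag. -/
theorem exists_of_flag {c : ℕ → Lat Δ} (hc : Monotone c) (hr : ∀ i ≤ r + 1, (c i).rk = i) :
    ∃ C : Δ.Chamber, ∀ i ≤ r + 1, C.flag i = c i := by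
  have hmem : ∀ v, (∃ i ≤ r + 1, c i = vert v) → c (Δ.typ v) = vert v := by
    rintro v ⟨i, hi, hv⟩
    have := hr i hi
    rw [hv] at this
    rw [show Δ.typ v = i from this, hv]
  have hch : Δ.IsChamber {v | ∃ i ≤ r + 1, c i = vert v} := by
    refine ⟨monotone_mem_simplices hc _, subset_antisymm ?_ ?_⟩
    · rintro _ ⟨v, -, rfl⟩; exact Δ.typ_mem v
    · rintro i ⟨h1, h2⟩
      obtain ⟨v, hv⟩ := exists_vert_of_rk (x := c i) (by rw [hr i (by omega)]; exact h1)
        (by rw [hr i (by omega)]; exact h2)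
      refine ⟨v, ⟨i, by omega, hv⟩, ?_⟩
      rw [← rk_vert (Δ := Δ), ← hv, hr i (by omega)]
  refine ⟨⟨_, hch⟩, fun i hi => ?_⟩
  have hx : c i ∈ Δ.hat {v | ∃ i ≤ r + 1, c i = vert v} := fun v hv => ⟨i, hi, hv⟩
  have := flag_eq ⟨_, hch⟩ hx
  rwa [hr i hi] at this

theorem ncard_eq (C : Δ.Chamber) : C.1.ncard = r := by
  rw [← (Δ.typ_injOn _ C.mem_simplices).ncard_image, C.2.2]
  rw [show Set.Icc 1 r = ((Finset.Icc 1 r : Finset ℕ) : Set ℕ) by simp, Set.ncard_coe_finset]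
  simp

theorem finite (C : Δ.Chamber) : C.1.Finite := by
  apply Set.Finite.of_finite_image _ (Δ.typ_injOn _ C.mem_simplices)
  rw [C.2.2]
  exact Set.finite_Icc 1 r

theorem isPanel_diff (C : Δ.Chamber) {u : V} (hu : u ∈ C.1) : Δ.IsPanel (C.1 \ {u}) := by
  refine ⟨Δ.down_closed _ C.mem_simplices _ Set.sdiff_subset, ?_⟩
  rw [Set.ncard_sdiff_singleton_add_one hu C.finite, C.ncard_eq]

/-- Thickness: a vertex of a chamber can be replaced by one that differs from two given ones. -/
theorem exists_third (C : Δ.Chamber) {u : V} (hu : u ∈ C.1) (a b : V) :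
    ∃ D : Δ.Chamber, C.1 \ {u} ⊆ D.1 ∧ ∃ w ∈ D.1, Δ.typ w = Δ.typ u ∧ w ≠ a ∧ w ≠ b := by
  by_contra! hcon
  have hthick := Δ.thick _ (C.isPanel_diff hu)
  have hsub : {D | Δ.IsChamber D ∧ C.1 \ {u} ⊆ D} ⊆ {insert a (C.1 \ {u}), insert b (C.1 \ {u})} := by
    rintro D ⟨hD, hCD⟩
    have hmem : Δ.typ u ∈ Δ.typ '' D := by rw [hD.2]; exact Δ.typ_mem u
    obtain ⟨w, hw, hwu⟩ := hmem
    have hDw : D = insert w (C.1 \ {u}) := by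
      apply subset_antisymm
      · intro x hx
        by_cases hxw : x = w
        · exact Or.inl hxw
        · right
          have : Δ.typ x ∈ Δ.typ '' C.1 := by rw [C.2.2]; exact Δ.typ_mem x
          obtain ⟨y, hy, hyx⟩ := this
          have hyu : y ≠ u := by
            rintro rfl
            exact hxw (Δ.typ_injOn D hD.1 hx hw (by rw [hwu, hyx]))
          have hyD : y ∈ D := hCD ⟨hy, hyu⟩
          rw [← Δ.typ_injOn D hD.1 hyD hx hyx]
          exact ⟨hy, hyu⟩
      · exact Set.insert_subset hw hCD
    by_cases hwa : w = a
    · left; rw [hDw, hwa]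
    · right
      rw [← hcon ⟨D, hD⟩ hCD w hw hwu hwa]
      exact hDw
  have h2 := Set.encard_le_encard hsub
  have h3 := hthick.trans (h2.trans (Set.encard_insert_le _ _))
  rw [Set.encard_singleton] at h3
  norm_num at h3

end Chamber

/-- The line spanned by two atoms carries a third atom. -/
theorem exists_third_atom {l : Lat Δ} (hl : l.rk = 2) (a b : Lat Δ) :
    ∃ c ≤ l, c.rk = 1 ∧ c ≠ a ∧ c ≠ b := by
  have hr : 1 ≤ r := by have := rk_le l; omega
  obtain ⟨C, hC⟩ := exists_chamber (verts_mem l)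
  obtain ⟨u, hu⟩ := exists_vert_of_rk (x := C.flag 1) (by rw [C.rk_flag (by omega)])
    (by rwa [C.rk_flag (by omega)])
  have huC : u ∈ C.1 := by
    rw [← vert_mem_hat (Δ := Δ), ← hu]; exact C.flag_mem 1
  have htu : Δ.typ u = 1 := by
    rw [← rk_vert (Δ := Δ), ← hu, C.rk_flag (by omega)]
  have hpick : ∀ a : Lat Δ, ∃ v : V, ∀ w : V, a = vert w → w = v := by
    intro a
    cases a with
    | bot => exact ⟨u, fun w h => by cases h⟩
    | top => exact ⟨u, fun w h => by cases h⟩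
    | vert v => exact ⟨v, fun w h => by injection h with h; exact h.symm⟩
  obtain ⟨va, hva⟩ := hpick a
  obtain ⟨vb, hvb⟩ := hpick b
  obtain ⟨D, hD, w, hw, hwu, hwa, hwb⟩ := C.exists_third huC va vb
  have hlD : l ∈ Δ.hat D.1 := by
    intro v hv
    refine hD ⟨hC hv, ?_⟩
    rintro rfl
    rw [mem_verts.1 hv, rk_vert] at hl
    omega
  refine ⟨vert w, le_of_rk_le D.mem_simplices (vert_mem_hat.2 hw) hlD ?_, ?_, ?_, ?_⟩
  · rw [hl, rk_vert, hwu, htu]; omega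
  · rw [rk_vert, hwu, htu]
  · intro h; exact hwa (hva w h.symm)
  · intro h; exact hwb (hvb w h.symm)

end BuildingA

/-! ### Inversions -/

/-- The number of inversions of a sequence of length `n`. -/
def inversions (n : ℕ) (f : ℕ → ℕ) : ℕ :=
  ((Finset.range n ×ˢ Finset.range n).filter (fun p => p.1 < p.2 ∧ f p.2 < f p.1)).card

theorem swap_lt_swap {k i j : ℕ} (hij : i < j) (hne : ¬ (i = k ∧ j = k + 1)) :
    Equiv.swap k (k + 1) i < Equiv.swap k (k + 1) j := by
  simp only [Equiv.swap_apply_def]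
  split_ifs <;> omega

theorem swap_lt {k n i : ℕ} (hk : k + 1 < n) (hi : i < n) : Equiv.swap k (k + 1) i < n := by
  simp only [Equiv.swap_apply_def]
  split_ifs <;> omega

theorem card_inversions_erase_le {n k : ℕ} (hk : k + 1 < n) (f g : ℕ → ℕ)
    (hg : ∀ i, g i = f (Equiv.swap k (k + 1) i)) :
    (((Finset.range n ×ˢ Finset.range n).filter (fun p => p.1 < p.2 ∧ g p.2 < g p.1)).erase
      (k, k + 1)).card ≤
    (((Finset.range n ×ˢ Finset.range n).filter (fun p => p.1 < p.2 ∧ f p.2 < f p.1)).erase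
      (k, k + 1)).card := by
  apply Finset.card_le_card_of_injOn
    (fun p => (Equiv.swap k (k + 1) p.1, Equiv.swap k (k + 1) p.2))
  · rintro ⟨i, j⟩ h
    simp only [Finset.coe_erase, Finset.coe_filter, Finset.mem_product, Finset.mem_range,
      Set.mem_sdiff, Set.mem_ofPred_eq, Set.mem_singleton_iff, Prod.mk.injEq] at h ⊢
    obtain ⟨⟨⟨hi, hj⟩, hij, hlt⟩, hne⟩ := h
    refine ⟨⟨⟨swap_lt hk hi, swap_lt hk hj⟩, swap_lt_swap hij hne, ?_⟩, ?_⟩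
    · rwa [← hg, ← hg]
    · rintro ⟨h1, h2⟩
      rw [Equiv.swap_apply_eq_iff, Equiv.swap_apply_left] at h1
      rw [Equiv.swap_apply_eq_iff, Equiv.swap_apply_right] at h2
      omega
  · rintro ⟨i, j⟩ - ⟨i', j'⟩ - h
    simp only [Prod.mk.injEq, EmbeddingLike.apply_eq_iff_eq] at h
    rw [h.1, h.2]

theorem inversions_swap_le {n k : ℕ} (hk : k + 1 < n) {f g : ℕ → ℕ}
    (hg : ∀ i, g i = f (Equiv.swap k (k + 1) i)) : inversions n g ≤ inversions n f + 1 := by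
  have h1 := card_inversions_erase_le hk f g hg
  have h2 := Finset.pred_card_le_card_erase
    (s := (Finset.range n ×ˢ Finset.range n).filter (fun p => p.1 < p.2 ∧ g p.2 < g p.1))
    (a := (k, k + 1))
  have h3 := Finset.card_erase_le
    (s := (Finset.range n ×ˢ Finset.range n).filter (fun p => p.1 < p.2 ∧ f p.2 < f p.1))
    (a := (k, k + 1))
  unfold inversions
  omega

theorem inversions_swap_lt {n k : ℕ} (hk : k + 1 < n) {f g : ℕ → ℕ}
    (hg : ∀ i, g i = f (Equiv.swap k (k + 1) i)) (hf : f (k + 1) < f k) :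
    inversions n g < inversions n f := by
  have h1 := card_inversions_erase_le hk f g hg
  have hgn : ¬ g (k + 1) < g k := by
    rw [hg, hg, Equiv.swap_apply_left, Equiv.swap_apply_right]; omega
  rw [Finset.erase_eq_of_notMem (by simp [hgn])] at h1
  have h3 := Finset.card_erase_add_one
    (s := (Finset.range n ×ˢ Finset.range n).filter (fun p => p.1 < p.2 ∧ f p.2 < f p.1))
    (a := (k, k + 1)) (by simp [hf]; omega)
  unfold inversions
  omega

theorem inversions_eq_zero {n : ℕ} {f : ℕ → ℕ} (hf : ∀ i j, i < j → j < n → f i ≤ f j) :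
    inversions n f = 0 := by
  unfold inversions
  rw [Finset.card_eq_zero, Finset.filter_eq_empty_iff]
  rintro ⟨i, j⟩ h ⟨h1, h2⟩
  simp only [Finset.mem_product, Finset.mem_range] at h
  exact absurd (hf i j h1 h.2) (not_le.2 h2)

theorem exists_threshold {f : ℕ → ℕ} (i s : ℕ) {t : ℕ} (hst : s ≤ t)
    (hf : ∀ k, s ≤ k → k + 1 < t → f k ≤ f (k + 1)) :
    ∃ j, s ≤ j ∧ j ≤ t ∧ (∀ k, s ≤ k → k < j → f k ≤ i) ∧ ∀ k, j ≤ k → k < t → i < f k := by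
  induction t, hst using Nat.le_induction with
  | base => exact ⟨s, le_rfl, le_rfl, fun k h1 h2 => by omega, fun k h1 h2 => by omega⟩
  | succ t hst ih =>
    obtain ⟨j, h1, h2, h3, h4⟩ := ih fun k hk hk' => hf k hk (by omega)
    by_cases hjt : j = t
    · subst hjt
      by_cases hfi : f j ≤ i
      · refine ⟨j + 1, by omega, le_rfl, fun k hk hk' => ?_, fun k hk hk' => by omega⟩
        rcases Nat.lt_or_ge k j with h | h
        · exact h3 k hk h
        · obtain rfl : k = j := by omega
          exact hfi
      · refine ⟨j, h1, by omega, h3, fun k hk hk' => ?_⟩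
        obtain rfl : k = j := by omega
        omega
    · refine ⟨j, h1, by omega, h3, fun k hk hk' => ?_⟩
      rcases Nat.lt_or_ge k t with h | h
      · exact h4 k hk h
      · obtain rfl : k = t := by omega
        obtain ⟨q, rfl⟩ : ∃ q, k = q + 1 := ⟨k - 1, by omega⟩
        exact (h4 q (by omega) (by omega)).trans_le (hf q (by omega) (by omega))

namespace BuildingA

open BuildingA.Lat

variable {r : ℕ} {V : Type*} {Δ : BuildingA r V}

namespace Lat

theorem eq_or_eq_of_rk_succ {x y z : Lat Δ} (h : y.rk = x.rk + 1) (hxz : x ≤ z) (hzy : z ≤ y) :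
    z = x ∨ z = y := by
  have h1 := rk_mono hxz
  have h2 := rk_mono hzy
  by_cases h3 : z.rk = x.rk
  · exact Or.inl (eq_of_le_of_rk_le hxz h3.le).symm
  · exact Or.inr (eq_of_le_of_rk_le hzy (by omega))

end Lat

namespace Chamber

/-- The first member of the flag of `C` meeting `b` outside `a`. -/
noncomputable def jump (C : Δ.Chamber) (a b : Lat Δ) : ℕ := sInf {i | ¬ C.flag i ⊓ b ≤ a}

/-- The first member of the flag of `C` whose meet with `b` spans `b` together with `a`. -/
noncomputable def full (C : Δ.Chamber) (a b : Lat Δ) : ℕ := sInf {i | b ≤ C.flag i ⊓ b ⊔ a}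

variable (C : Δ.Chamber) {a b x : Lat Δ}

theorem not_top_inf_le (h : a < b) : ¬ C.flag (r + 1) ⊓ b ≤ a := by
  rw [C.flag_top le_rfl, top_inf_eq]
  exact not_le_of_gt h

theorem jump_spec (h : a < b) : ¬ C.flag (C.jump a b) ⊓ b ≤ a :=
  Nat.sInf_mem (s := {i | ¬ C.flag i ⊓ b ≤ a}) ⟨r + 1, C.not_top_inf_le h⟩

theorem jump_le {i : ℕ} (h : ¬ C.flag i ⊓ b ≤ a) : C.jump a b ≤ i := Nat.sInf_le h

theorem inf_le_of_lt_jump {i : ℕ} (h : i < C.jump a b) : C.flag i ⊓ b ≤ a := by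
  by_contra hn
  exact absurd (C.jump_le hn) (not_le.2 h)

theorem full_spec : b ≤ C.flag (C.full a b) ⊓ b ⊔ a :=
  Nat.sInf_mem (s := {i | b ≤ C.flag i ⊓ b ⊔ a})
    ⟨r + 1, by
      change b ≤ C.flag (r + 1) ⊓ b ⊔ a
      rw [C.flag_top le_rfl, top_inf_eq]; exact le_sup_left⟩

theorem full_le {i : ℕ} (h : b ≤ C.flag i ⊓ b ⊔ a) : C.full a b ≤ i := Nat.sInf_le h

theorem rk_flag_succ_inf_le (k : ℕ) (b : Lat Δ) :
    (C.flag (k + 1) ⊓ b).rk ≤ (C.flag k ⊓ b).rk + 1 := by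
  rcases Nat.lt_or_ge r k with hk | hk
  · rw [C.flag_top (by omega), C.flag_top (by omega)]; omega
  have h1 := rk_sup_add_rk_inf (C.flag k) (C.flag (k + 1) ⊓ b)
  have h2 : C.flag k ⊓ (C.flag (k + 1) ⊓ b) = C.flag k ⊓ b := by
    rw [← inf_assoc, inf_eq_left.2 (C.flag_mono (Nat.le_succ k))]
  have h3 : (C.flag k ⊔ C.flag (k + 1) ⊓ b).rk ≤ k + 1 := by
    have := rk_mono (sup_le (C.flag_mono (Nat.le_succ k))
      (inf_le_left : C.flag (k + 1) ⊓ b ≤ _))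
    rwa [C.rk_flag (i := k + 1) (by omega)] at this
  rw [h2, C.rk_flag (by omega)] at h1
  omega

theorem rk_jump_sup_le (h : a < b) : (C.flag (C.jump a b) ⊓ b ⊔ a).rk ≤ a.rk + 1 := by
  rcases hi : C.jump a b with _ | k
  · have := C.jump_spec h
    rw [hi, C.flag_zero, bot_inf_eq] at this
    exact absurd bot_le this
  · have h0 : C.flag k ⊓ b ≤ a := C.inf_le_of_lt_jump (by omega)
    have h1 := C.rk_flag_succ_inf_le k b
    have h2 := rk_sup_add_rk_inf (C.flag (k + 1) ⊓ b) a
    have h3 : (C.flag k ⊓ b).rk ≤ (C.flag (k + 1) ⊓ b ⊓ a).rk :=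
      rk_mono (le_inf (inf_le_inf_right b (C.flag_mono (Nat.le_succ k))) h0)
    omega

theorem jump_lt_full (h : a < b) (hr : b.rk = a.rk + 2) : C.jump a b < C.full a b := by
  by_contra hn
  have h1 : b ≤ C.flag (C.jump a b) ⊓ b ⊔ a :=
    C.full_spec.trans (sup_le_sup_right (inf_le_inf_right b (C.flag_mono (not_lt.1 hn))) a)
  have := rk_mono h1
  have := C.rk_jump_sup_le h
  omega

theorem jump_pair (hax : a < x) (hxb : x < b) (hr : b.rk = a.rk + 2) :
    (C.jump a x = C.jump a b ∧ C.jump x b = C.full a b) ∨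
      (C.jump a x = C.full a b ∧ C.jump x b = C.jump a b) := by
  have hab := hax.trans hxb
  have hrx : x.rk = a.rk + 1 := by
    have := rk_lt hax
    have := rk_lt hxb
    omega
  have l1 : C.jump a b ≤ C.jump a x :=
    C.jump_le fun h => C.jump_spec hax ((inf_le_inf_left _ hxb.le).trans h)
  have l2 : C.jump a b ≤ C.jump x b := C.jump_le fun h => C.jump_spec hxb (h.trans hax.le)
  have u1 : C.jump a x ≤ C.full a b := by
    refine C.jump_le fun h => ?_
    have h1 : x ≤ (a ⊔ C.flag (C.full a b) ⊓ b) ⊓ x :=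
      le_inf (hxb.le.trans (by rw [sup_comm]; exact C.full_spec)) le_rfl
    rw [sup_inf_assoc_of_le _ hax.le, inf_assoc, inf_eq_right.2 hxb.le, sup_eq_left.2 h] at h1
    exact not_le_of_gt hax h1
  have u2 : C.jump x b ≤ C.full a b := by
    refine C.jump_le fun h => ?_
    exact not_le_of_gt hxb (C.full_spec.trans (sup_le h hax.le))
  have e1 : C.jump a x = C.jump a b ∨ C.jump x b = C.jump a b := by
    by_cases h : C.flag (C.jump a b) ⊓ b ≤ x
    · left
      refine le_antisymm (C.jump_le fun h' => C.jump_spec hab ?_) l1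
      exact (le_inf inf_le_left h).trans h'
    · right
      exact le_antisymm (C.jump_le h) l2
  have e2 : C.jump a x = C.full a b ∨ C.jump x b = C.full a b := by
    by_contra! hne
    have h1 : C.jump a x < C.full a b := lt_of_le_of_ne u1 hne.1
    have h2 : C.jump x b < C.full a b := lt_of_le_of_ne u2 hne.2
    obtain ⟨i, hi, hi1, hi2⟩ : ∃ i, i < C.full a b ∧ C.jump a x ≤ i ∧ C.jump x b ≤ i :=
      ⟨max (C.jump a x) (C.jump x b), max_lt h1 h2, le_max_left _ _, le_max_right _ _⟩
    have h3 : x ≤ C.flag i ⊓ x ⊔ a := by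
      rcases eq_or_eq_of_rk_succ hrx (le_sup_right (a := C.flag (C.jump a x) ⊓ x))
        (sup_le inf_le_right hax.le) with h | h
      · exact absurd (sup_eq_right.1 h) (C.jump_spec hax)
      · exact h.ge.trans (sup_le_sup_right (inf_le_inf_right _ (C.flag_mono hi1)) _)
    have h4 : b ≤ C.flag i ⊓ b ⊔ x := by
      rcases eq_or_eq_of_rk_succ (show b.rk = x.rk + 1 by omega)
        (le_sup_right (a := C.flag (C.jump x b) ⊓ b)) (sup_le inf_le_right hxb.le) with h | h
      · exact absurd (sup_eq_right.1 h) (C.jump_spec hxb)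
      · exact h.ge.trans (sup_le_sup_right (inf_le_inf_right _ (C.flag_mono hi2)) _)
    refine absurd (C.full_le (i := i) (h4.trans (sup_le le_sup_left (h3.trans ?_)))) (not_le.2 hi)
    exact sup_le_sup_right (inf_le_inf_left _ hxb.le) _
  have := C.jump_lt_full hab hr
  omega

/-- The relative position of two chambers, as a sequence. -/
noncomputable def pos (C D : Δ.Chamber) (j : ℕ) : ℕ := C.jump (D.flag j) (D.flag (j + 1))

theorem flag_lt (D : Δ.Chamber) {i j : ℕ} (hij : i < j) (hj : j ≤ r + 1) :
    D.flag i < D.flag j := by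
  refine lt_of_le_of_ne (D.flag_mono hij.le) fun h => ?_
  have := congrArg rk h
  rw [D.rk_flag hj, D.rk_flag (by omega)] at this
  omega

variable {C} {D D' : Δ.Chamber}

theorem pos_of_agree {k : ℕ} (hk : k + 1 ≤ r) (h : ∀ i, i ≠ k + 1 → D'.flag i = D.flag i) :
    (∀ j, C.pos D' j = C.pos D j) ∨ ∀ j, C.pos D' j = C.pos D (Equiv.swap k (k + 1) j) := by
  have hother : ∀ j, j ≠ k → j ≠ k + 1 → C.pos D' j = C.pos D j := by
    intro j h1 h2
    unfold pos
    rw [h j h2, h (j + 1) (by omega)]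
  have hr : (D.flag (k + 2)).rk = (D.flag k).rk + 2 := by
    rw [D.rk_flag (by omega), D.rk_flag (by omega)]
  have e0 := h k (by omega)
  have e2 := h (k + 2) (by omega)
  have p1 := C.jump_pair (D.flag_lt (i := k) (j := k + 1) (by omega) (by omega))
    (D.flag_lt (i := k + 1) (j := k + 2) (by omega) (by omega)) hr
  have p2 := C.jump_pair (D'.flag_lt (i := k) (j := k + 1) (by omega) (by omega))
    (D'.flag_lt (i := k + 1) (j := k + 2) (by omega) (by omega)) (by rw [e0, e2]; exact hr)
  rw [e0, e2] at p2
  have q1 : C.pos D k = C.jump (D.flag k) (D.flag (k + 1)) := rfl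
  have q2 : C.pos D (k + 1) = C.jump (D.flag (k + 1)) (D.flag (k + 2)) := rfl
  have q3 : C.pos D' k = C.jump (D.flag k) (D'.flag (k + 1)) := by unfold pos; rw [e0]
  have q4 : C.pos D' (k + 1) = C.jump (D'.flag (k + 1)) (D.flag (k + 2)) := by
    unfold pos; rw [← e2]
  have hcase : (C.pos D' k = C.pos D k ∧ C.pos D' (k + 1) = C.pos D (k + 1)) ∨
      (C.pos D' k = C.pos D (k + 1) ∧ C.pos D' (k + 1) = C.pos D k) := by omega
  rcases hcase with hc | hc
  · left
    intro j
    by_cases h1 : j = k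
    · rw [h1, hc.1]
    by_cases h2 : j = k + 1
    · rw [h2, hc.2]
    exact hother j h1 h2
  · right
    intro j
    by_cases h1 : j = k
    · rw [h1, hc.1, Equiv.swap_apply_left]
    by_cases h2 : j = k + 1
    · rw [h2, hc.2, Equiv.swap_apply_right]
    rw [Equiv.swap_apply_of_ne_of_ne h1 h2]
    exact hother j h1 h2

/-- The number of inversions of the relative position. -/
noncomputable def inv (C D : Δ.Chamber) : ℕ := inversions (r + 1) (C.pos D)

theorem inv_le_of_agree {k : ℕ} (hk : k + 1 ≤ r) (h : ∀ i, i ≠ k + 1 → D'.flag i = D.flag i) :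
    C.inv D' ≤ C.inv D + 1 := by
  rcases pos_of_agree (C := C) hk h with h | h
  · unfold inv
    rw [funext h]
    exact Nat.le_succ _
  · exact inversions_swap_le (by omega) h

theorem exists_inv_lt {k : ℕ} (hk : k + 1 ≤ r) (hd : C.pos D (k + 1) < C.pos D k) :
    ∃ D' : Δ.Chamber, (∀ i, i ≠ k + 1 → D'.flag i = D.flag i) ∧ C.inv D' < C.inv D := by
  have hr : (D.flag (k + 2)).rk = (D.flag k).rk + 2 := by
    rw [D.rk_flag (by omega), D.rk_flag (by omega)]
  have hab : D.flag k < D.flag (k + 2) := D.flag_lt (by omega) (by omega)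
  set w := C.flag (C.jump (D.flag k) (D.flag (k + 2))) ⊓ D.flag (k + 2) ⊔ D.flag k with hw
  have haw : D.flag k < w := by
    refine lt_of_le_of_ne le_sup_right fun h => C.jump_spec hab ?_
    rw [hw] at h
    exact sup_eq_right.1 h.symm
  have hwb : w ≤ D.flag (k + 2) := sup_le inf_le_right hab.le
  have hwr : w.rk = k + 1 := by
    have h1 : w.rk ≤ _ := C.rk_jump_sup_le hab
    have h2 := rk_lt haw
    rw [D.rk_flag (by omega)] at h1 h2
    omega
  have hmono : Monotone (Function.update D.flag (k + 1) w) := by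
    apply monotone_nat_of_le_succ
    intro i
    simp only [Function.update_apply]
    by_cases h1 : i = k + 1
    · subst h1
      rw [if_pos rfl, if_neg (by omega)]
      exact hwb
    rw [if_neg h1]
    by_cases h2 : i = k
    · subst h2
      rw [if_pos rfl]
      exact haw.le
    rw [if_neg (by omega)]
    exact D.flag_mono (Nat.le_succ i)
  obtain ⟨D', hD'⟩ := exists_of_flag hmono (by
    intro i hi
    simp only [Function.update_apply]
    split_ifs with h
    · rw [hwr, h]
    · exact D.rk_flag hi)
  have hag : ∀ i, i ≠ k + 1 → D'.flag i = D.flag i := by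
    intro i hi
    rcases le_or_gt i (r + 1) with h | h
    · rw [hD' i h, Function.update_of_ne hi]
    · rw [D'.flag_top h.le, D.flag_top h.le]
  have hDw : D'.flag (k + 1) = w := by
    rw [hD' _ (by omega), Function.update_self]
  refine ⟨D', hag, ?_⟩
  have hpos : C.pos D' k ≤ C.jump (D.flag k) (D.flag (k + 2)) := by
    unfold pos
    rw [hDw, hag k (by omega)]
    refine C.jump_le fun h => C.jump_spec hab ?_
    exact (le_inf inf_le_left le_sup_left).trans h
  rcases pos_of_agree (C := C) hk hag with h | h
  · exfalso
    have p1 := C.jump_pair (D.flag_lt (i := k) (j := k + 1) (by omega) (by omega))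
      (D.flag_lt (i := k + 1) (j := k + 2) (by omega) (by omega)) hr
    have q1 : C.pos D k = C.jump (D.flag k) (D.flag (k + 1)) := rfl
    have q2 : C.pos D (k + 1) = C.jump (D.flag (k + 1)) (D.flag (k + 2)) := rfl
    have := h k
    have := C.jump_lt_full hab hr
    omega
  · exact inversions_swap_lt (by omega) h hd

/-- Without descents in `[s, t]`, the members of the flag of `C` project into the flag of `D`. -/
theorem proj_mem_hat {s t : ℕ} (hst : s ≤ t) (ht : t ≤ r + 1)
    (h : ∀ k, s ≤ k → k + 1 < t → C.pos D k ≤ C.pos D (k + 1)) (i : ℕ) :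
    C.flag i ⊓ D.flag t ⊔ D.flag s ∈ Δ.hat D.1 := by
  obtain ⟨j, hsj, hjt, h1, h2⟩ := exists_threshold i s hst h
  suffices C.flag i ⊓ D.flag t ⊔ D.flag s = D.flag j by rw [this]; exact D.flag_mem j
  apply le_antisymm
  · refine sup_le ?_ (D.flag_mono hsj)
    have key : ∀ m, j ≤ m → m ≤ t → C.flag i ⊓ D.flag m ≤ D.flag j := by
      intro m hm
      induction m, hm using Nat.le_induction with
      | base => intro _; exact inf_le_right
      | succ m hm ih =>
        intro hmt
        have := C.inf_le_of_lt_jump (h2 m hm (by omega))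
        exact (le_inf inf_le_left this).trans (ih (by omega))
    exact key t hjt le_rfl
  · have key : ∀ m, s ≤ m → m ≤ j → D.flag m ≤ C.flag i ⊓ D.flag t ⊔ D.flag s := by
      intro m hm
      induction m, hm using Nat.le_induction with
      | base => intro _; exact le_sup_right
      | succ m hm ih =>
        intro hmj
        have hlt : D.flag m < D.flag (m + 1) := D.flag_lt (by omega) (by omega)
        have hj := C.jump_spec hlt
        have hle : C.flag (C.jump (D.flag m) (D.flag (m + 1))) ≤ C.flag i :=
          C.flag_mono (h1 m hm (by omega))
        rcases eq_or_eq_of_rk_succ (x := D.flag m) (y := D.flag (m + 1))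
          (z := C.flag i ⊓ D.flag (m + 1) ⊔ D.flag m)
          (by rw [D.rk_flag (by omega), D.rk_flag (by omega)]) le_sup_right
          (sup_le inf_le_right hlt.le) with e | e
        · exact absurd ((inf_le_inf_right _ hle).trans (sup_eq_right.1 e)) hj
        · rw [← e]
          refine sup_le (le_sup_of_le_left ?_) (ih (by omega))
          exact inf_le_inf_left _ (D.flag_mono (by omega))
    exact key j hsj le_rfl

theorem eq_of_no_descent (h : ∀ k, k + 1 ≤ r → C.pos D k ≤ C.pos D (k + 1)) : C = D := by
  refine ext_flag fun i _ hi => ?_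
  have := proj_mem_hat (C := C) (D := D) (Nat.zero_le _) le_rfl
    (fun k _ hk => h k (by omega)) i
  rw [D.flag_zero, D.flag_top le_rfl, inf_top_eq, sup_bot_eq] at this
  exact eq_of_rk_eq D.mem_simplices this (D.flag_mem i)
    (by rw [C.rk_flag (by omega), D.rk_flag (by omega)])

theorem inv_self (C : Δ.Chamber) : C.inv C = 0 := by
  have key : ∀ j ≤ r, C.pos C j = j + 1 := by
    intro j hj
    have hlt : C.flag j < C.flag (j + 1) := C.flag_lt (by omega) (by omega)
    apply le_antisymm
    · apply C.jump_le
      rw [inf_idem]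
      exact not_le_of_gt hlt
    · by_contra hn
      refine C.jump_spec hlt (inf_le_left.trans (C.flag_mono ?_))
      unfold pos at hn
      omega
  apply inversions_eq_zero
  intro i j hij hj
  rw [key i (by omega), key j (by omega)]
  omega

theorem exists_agree_of_adj (h : Δ.chamberGraph.Adj D D') :
    ∃ k, k + 1 ≤ r ∧ ∀ i, i ≠ k + 1 → D.flag i = D'.flag i := by
  obtain ⟨-, hs, hc⟩ := h
  have himg : Δ.typ '' (D.1 ∩ D'.1) ⊆ Set.Icc 1 r := by
    rintro _ ⟨v, -, rfl⟩; exact Δ.typ_mem v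
  have hcard : (Set.Icc 1 r \ Δ.typ '' (D.1 ∩ D'.1)).ncard = 1 := by
    rw [Set.ncard_sdiff himg ((Set.finite_Icc 1 r).subset himg),
      (Δ.typ_injOn _ hs).ncard_image, ← D.2.2, (Δ.typ_injOn _ D.mem_simplices).ncard_image,
      D.ncard_eq]
    omega
  obtain ⟨m, hm⟩ := Set.ncard_eq_one.1 hcard
  have hmem : m ∈ Set.Icc 1 r \ Δ.typ '' (D.1 ∩ D'.1) := hm ▸ rfl
  have h1 : 1 ≤ m := hmem.1.1
  have h2 : m ≤ r := hmem.1.2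
  refine ⟨m - 1, by omega, fun i hi => ?_⟩
  rcases Nat.lt_or_ge r i with h | h
  · rw [D.flag_top h, D'.flag_top h]
  rcases Nat.eq_zero_or_pos i with rfl | h0
  · rw [D.flag_zero, D'.flag_zero]
  have : i ∈ Δ.typ '' (D.1 ∩ D'.1) := by
    by_contra hn
    have : i ∈ Set.Icc 1 r \ Δ.typ '' (D.1 ∩ D'.1) := ⟨⟨h0, h⟩, hn⟩
    rw [hm] at this
    have : i = m := this
    omega
  obtain ⟨v, hv, rfl⟩ := this
  rw [D.mem_iff_flag.1 hv.1, D'.mem_iff_flag.1 hv.2]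

theorem adj_of_agree {k : ℕ} (hk : k + 1 ≤ r) (h : ∀ i, i ≠ k + 1 → D'.flag i = D.flag i)
    (hne : D ≠ D') : Δ.chamberGraph.Adj D D' := by
  refine ⟨hne, ?_⟩
  obtain ⟨u, hu⟩ := exists_vert_of_rk (x := D.flag (k + 1)) (by rw [D.rk_flag (by omega)]; omega)
    (by rw [D.rk_flag (by omega)]; omega)
  have htu : Δ.typ u = k + 1 := by
    rw [← rk_vert (Δ := Δ), ← hu, D.rk_flag (by omega)]
  have huD : u ∈ D.1 := by rw [D.mem_iff_flag, htu, hu]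
  have e : D.1 ∩ D'.1 = D.1 \ {u} := by
    ext v
    constructor
    · rintro ⟨h1, h2⟩
      refine ⟨h1, ?_⟩
      rintro rfl
      refine hne (ext_flag fun i _ _ => ?_)
      by_cases hi : i = k + 1
      · rw [hi, ← htu, D.mem_iff_flag.1 h1, D'.mem_iff_flag.1 h2]
      · exact (h i hi).symm
    · rintro ⟨h1, h2⟩
      refine ⟨h1, ?_⟩
      rw [D'.mem_iff_flag, h _ ?_, D.mem_iff_flag.1 h1]
      intro ht
      exact h2 (Δ.typ_injOn _ D.mem_simplices h1 huD (by rw [ht, htu]))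
  rw [e]
  exact D.isPanel_diff huD

theorem inv_le_length {D C : Δ.Chamber} (w : Δ.chamberGraph.Walk D C) : C.inv D ≤ w.length := by
  induction w with
  | nil => rw [inv_self]; exact Nat.zero_le _
  | cons h w ih =>
    obtain ⟨k, hk, hag⟩ := exists_agree_of_adj h
    rw [SimpleGraph.Walk.length_cons]
    exact (inv_le_of_agree hk hag).trans (Nat.succ_le_succ ih)

theorem exists_walk_of_inv (C : Δ.Chamber) : ∀ (m : ℕ) (D : Δ.Chamber), C.inv D ≤ m →
    ∃ w : Δ.chamberGraph.Walk D C, w.length ≤ m := by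
  intro m
  induction m with
  | zero =>
    intro D hD
    by_cases hd : ∃ k, k + 1 ≤ r ∧ C.pos D (k + 1) < C.pos D k
    · obtain ⟨k, hk, hlt⟩ := hd
      obtain ⟨D', -, h⟩ := exists_inv_lt hk hlt
      omega
    · push Not at hd
      obtain rfl := eq_of_no_descent hd
      exact ⟨SimpleGraph.Walk.nil, le_rfl⟩
  | succ m ih =>
    intro D hD
    by_cases hd : ∃ k, k + 1 ≤ r ∧ C.pos D (k + 1) < C.pos D k
    · obtain ⟨k, hk, hlt⟩ := hd
      obtain ⟨D', hag, h⟩ := exists_inv_lt hk hlt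
      obtain ⟨w, hw⟩ := ih D' (by omega)
      have hne : D ≠ D' := by rintro rfl; omega
      refine ⟨SimpleGraph.Walk.cons (adj_of_agree hk hag hne) w, ?_⟩
      rw [SimpleGraph.Walk.length_cons]
      omega
    · push Not at hd
      obtain rfl := eq_of_no_descent hd
      exact ⟨SimpleGraph.Walk.nil, Nat.zero_le _⟩

/-- The gallery distance is the number of inversions of the relative position. -/
theorem dist_eq_inv (C D : Δ.Chamber) : Δ.chamberGraph.dist C D = C.inv D := by
  rw [SimpleGraph.dist_comm]
  obtain ⟨w, hw⟩ := C.exists_walk_of_inv _ D le_rfl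
  obtain ⟨w', hw'⟩ := SimpleGraph.Reachable.exists_walk_length_eq_dist ⟨w⟩
  have h1 := SimpleGraph.dist_le w
  have h2 := inv_le_length w'
  omega

end Chamber

theorem exists_isProjection {F' : Set V} (hF' : F' ∈ Δ.simplices) (C : Δ.Chamber) :
    ∃ C', Δ.IsProjection F' C C' := by
  obtain ⟨C₀, hC₀⟩ := exists_chamber hF'
  let P : ℕ → Prop := fun m => ∃ D : Δ.Chamber, F' ⊆ D.1 ∧ Δ.chamberGraph.dist C D = m
  have hex : ∃ m, P m := ⟨_, C₀, hC₀, rfl⟩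
  classical
  obtain ⟨D, hD, hm⟩ := Nat.find_spec hex
  exact ⟨D, hD, fun D' hD' => by rw [hm]; exact Nat.find_min' hex ⟨D', hD', rfl⟩⟩

/-- The projection of a chamber `C` to `F'` contains the lattice projections of the elements
of `C`. -/
theorem IsProjection.mem_hat {F' : Set V} {C C' : Δ.Chamber} (h : Δ.IsProjection F' C C')
    {y z : Lat Δ} (hg : IsFlagGap F' y z) {c : Lat Δ} (hc : c ∈ Δ.hat C.1) :
    c ⊓ z ⊔ y ∈ Δ.hat C'.1 := by
  rw [← C.flag_eq hc, ← C'.flag_eq (hat_mono h.1 hg.right_mem),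
    ← C'.flag_eq (hat_mono h.1 hg.left_mem)]
  refine Chamber.proj_mem_hat (rk_mono hg.lt.le) (rk_le z) (fun k hk hk' => ?_) _
  by_contra hd
  have hkr : k + 1 ≤ r := by have := rk_le z; omega
  obtain ⟨D', hag, hlt⟩ := Chamber.exists_inv_lt hkr (not_le.1 hd)
  have hsub : F' ⊆ D'.1 := by
    intro v hv
    rw [D'.mem_iff_flag, hag, C'.mem_iff_flag.1 (h.1 hv)]
    rcases hg.le_or_le _ (vert_mem_hat.2 hv) with h | h
    · have := rk_mono h
      rw [rk_vert] at this
      omega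
    · have := rk_mono h
      rw [rk_vert] at this
      omega
  have := h.2 D' hsub
  rw [Chamber.dist_eq_inv, Chamber.dist_eq_inv] at this
  omega

end BuildingA

/-! ### Opposite simplices and perspectivities -/

namespace BuildingA

open BuildingA.Lat CoxVertex

variable {r : ℕ} {V : Type*} {Δ : BuildingA r V}

theorem isCompl_latChart_iff {A : Set (Set V)} {e : CoxVertex r → V} (hA : A ∈ Δ.apartments)
    (he : Δ.IsChart A e) {X Y : Finset (Fin (r + 1))} :
    IsCompl (Δ.latChart e X) (Δ.latChart e Y) ↔ Y = Xᶜ := by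
  rw [isCompl_iff, disjoint_iff, codisjoint_iff, ← latChart_inf hA he, ← latChart_sup hA he,
    bot_eq, top_eq, ← latChart_empty e, ← latChart_univ e, (latChart_injective hA he).eq_iff,
    (latChart_injective hA he).eq_iff]
  constructor
  · rintro ⟨h1, h2⟩
    exact (IsCompl.of_eq (x := X) (y := Y) h1 h2).compl_eq.symm
  · rintro rfl
    exact ⟨Finset.inter_compl X, Finset.union_compl X⟩

theorem Lat.rk_add_of_isCompl {x y : Lat Δ} (h : IsCompl x y) : x.rk + y.rk = r + 1 := by
  have := rk_sup_add_rk_inf x y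
  rw [h.sup_eq_top, h.inf_eq_bot, rk_top, rk_bot] at this
  omega

variable (Δ) in
/-- The flags `F` and `G` consist of complementary elements. -/
structure IsComplFlag (F G : Set V) : Prop where
  left_mem : F ∈ Δ.simplices
  right_mem : G ∈ Δ.simplices
  exists_right : ∀ x ∈ Δ.hat F, ∃ y ∈ Δ.hat G, IsCompl x y
  exists_left : ∀ y ∈ Δ.hat G, ∃ x ∈ Δ.hat F, IsCompl y x

theorem IsComplFlag.symm {F G : Set V} (h : Δ.IsComplFlag F G) : Δ.IsComplFlag G F :=
  ⟨h.right_mem, h.left_mem, h.exists_left, h.exists_right⟩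

theorem opposite_iff {F G : Set V} : Δ.Opposite F G ↔ Δ.IsComplFlag F G := by
  constructor
  · rintro ⟨A, hA, e, he, F₀, G₀, ⟨hF, hG, h1, h2⟩, rfl, rfl⟩
    have key : ∀ F₀ G₀ : Set (CoxVertex r), (∀ x ∈ F₀, ∀ y, OppVertex x y → y ∈ G₀) →
        ∀ x ∈ Δ.hat (e '' F₀), ∃ y ∈ Δ.hat (e '' G₀), IsCompl x y := by
      intro F₀ G₀ h x hx
      cases x with
      | bot => exact ⟨⊤, top_mem_hat _, isCompl_bot_top⟩
      | top => exact ⟨⊥, bot_mem_hat _, isCompl_top_bot⟩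
      | vert v =>
        obtain ⟨x, hx₀, rfl⟩ := vert_mem_hat.1 hx
        refine ⟨vert (e (complAut x)), vert_mem_hat.2 ⟨_, h x hx₀ _ (oppVertex_iff.2 rfl), rfl⟩, ?_⟩
        rw [← latChart_coe, ← latChart_coe, isCompl_latChart_iff hA he]
        rfl
    exact ⟨Δ.apartment_subset A hA ((mem_chart_iff he).2 ⟨F₀, hF, rfl⟩),
      Δ.apartment_subset A hA ((mem_chart_iff he).2 ⟨G₀, hG, rfl⟩), key F₀ G₀ h1, key G₀ F₀ h2⟩
  · intro h
    obtain ⟨A, hA, e, he, hFA, hGA, -⟩ := exists_common_chart h.left_mem h.right_mem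
    obtain ⟨F₀, hF₀, rfl⟩ := (mem_chart_iff he).1 hFA
    obtain ⟨G₀, hG₀, rfl⟩ := (mem_chart_iff he).1 hGA
    have key : ∀ F₀ G₀ : Set (CoxVertex r), (e '' G₀ ∈ A) →
        (∀ x ∈ Δ.hat (e '' F₀), ∃ y ∈ Δ.hat (e '' G₀), IsCompl x y) →
        ∀ x ∈ F₀, ∀ y, OppVertex x y → y ∈ G₀ := by
      intro F₀ G₀ hG h x hx y hxy
      obtain ⟨z, hz, hc⟩ := h (vert (e x)) (vert_mem_hat.2 ⟨x, hx, rfl⟩)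
      obtain ⟨Z, rfl⟩ := exists_latChart_eq he (chart_down_closed he hG hz)
      rw [← latChart_coe, isCompl_latChart_iff hA he, ← oppVertex_iff.1 hxy] at hc
      rw [hc, latChart_coe, vert_mem_hat, he.1.mem_set_image] at hz
      exact hz
    exact ⟨A, hA, e, he, F₀, G₀, ⟨hF₀, hG₀, key F₀ G₀ hGA h.exists_right,
      key G₀ F₀ hFA h.exists_left⟩, rfl, rfl⟩

theorem IsComplFlag.mem_typ {F G : Set V} (h : Δ.IsComplFlag F G) {t : ℕ}
    (ht : t ∈ Δ.typ '' F) : r + 1 - t ∈ Δ.typ '' G := by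
  obtain ⟨v, hv, rfl⟩ := ht
  obtain ⟨y, hy, hc⟩ := h.exists_right (vert v) (vert_mem_hat.2 hv)
  have h1 := rk_add_of_isCompl hc
  have h2 := rk_vert_mem (Δ := Δ) v
  rw [rk_vert] at h1 h2
  have e : r + 1 - Δ.typ v = y.rk := by omega
  rw [e]
  rcases rk_mem_of_mem_hat hy with h3 | h3 | h3
  · omega
  · omega
  · exact h3

theorem IsComplFlag.typ_image {F G : Set V} (h : Δ.IsComplFlag F G) :
    Δ.typ '' G = {t | t ≤ r ∧ r + 1 - t ∈ Δ.typ '' F} := by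
  ext t
  constructor
  · intro ht
    refine ⟨?_, h.symm.mem_typ ht⟩
    obtain ⟨v, -, rfl⟩ := ht
    exact (Δ.typ_mem v).2
  · rintro ⟨h1, h2⟩
    have := h.mem_typ h2
    rwa [show r + 1 - (r + 1 - t) = t by omega] at this

theorem IsFlagGap.compl {F G : Set V} (h : Δ.IsComplFlag F G) {x y x' y' : Lat Δ}
    (hg : IsFlagGap F x y) (hx' : x' ∈ Δ.hat G) (hy' : y' ∈ Δ.hat G) (hx : IsCompl x x')
    (hy : IsCompl y y') : IsFlagGap G y' x' := by
  have h1 := rk_add_of_isCompl hx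
  have h2 := rk_add_of_isCompl hy
  have h3 := rk_lt hg.lt
  refine ⟨hy', hx', lt_of_le_of_ne (le_of_rk_le h.right_mem hy' hx' (by omega)) ?_, ?_⟩
  · intro e
    rw [e] at h2
    omega
  · intro z hz
    obtain ⟨w, hw, hzw⟩ := h.exists_left z hz
    have h4 := rk_add_of_isCompl hzw
    rcases hg.le_or_le w hw with h5 | h5
    · have := rk_mono h5
      exact Or.inr (le_of_rk_le h.right_mem hx' hz (by omega))
    · have := rk_mono h5
      exact Or.inl (le_of_rk_le h.right_mem hz hy' (by omega))

namespace Residue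

/-- The vertex of the building underlying a vertex of a residue. -/
def toLat {F : Set V} (v : Δ.Residue F) : Lat Δ := vert v.1

theorem toLat_injective {F : Set V} : Function.Injective (toLat : Δ.Residue F → Lat Δ) := by
  intro v w h
  apply Subtype.ext
  injection h

theorem typ_notMem {F : Set V} (v : Δ.Residue F) : Δ.typ v.1 ∉ Δ.typ '' F := by
  rintro ⟨w, hw, h⟩
  have := Δ.typ_injOn _ v.2.2 (Or.inr hw) (Or.inl rfl) h
  exact v.2.1 (this ▸ hw)

/-- The vertex `v` of the residue lies between the consecutive members `x`, `y` of the flag. -/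
def Between {F : Set V} (v : Δ.Residue F) (x y : Lat Δ) : Prop :=
  IsFlagGap F x y ∧ x < v.toLat ∧ v.toLat < y

theorem between_iff_rk {F : Set V} (v : Δ.Residue F) {x y : Lat Δ} (h : IsFlagGap F x y) :
    v.Between x y ↔ x.rk < Δ.typ v.1 ∧ Δ.typ v.1 < y.rk := by
  constructor
  · rintro ⟨-, h1, h2⟩
    exact ⟨rk_lt h1, rk_lt h2⟩
  · rintro ⟨h1, h2⟩
    have hv : v.toLat ∈ Δ.hat (insert v.1 F) := vert_mem_hat.2 (Or.inl rfl)
    have hx := hat_mono (Set.subset_insert v.1 F) h.left_mem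
    have hy := hat_mono (Set.subset_insert v.1 F) h.right_mem
    have hrk : v.toLat.rk = Δ.typ v.1 := rfl
    refine ⟨h, lt_of_le_of_ne (le_of_rk_le v.2.2 hx hv (by omega)) ?_,
      lt_of_le_of_ne (le_of_rk_le v.2.2 hv hy (by omega)) ?_⟩
    · rintro rfl; omega
    · rintro rfl; omega

theorem exists_between {F : Set V} (hF : F ∈ Δ.simplices) (v : Δ.Residue F) :
    ∃ x y, v.Between x y := by
  have hv := Δ.typ_mem v.1
  have h1 : 1 ≤ Δ.typ v.1 := hv.1
  have h2 : Δ.typ v.1 ≤ r := hv.2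
  obtain ⟨a, b, hg, ha, hb⟩ := exists_isGap v.typ_notMem (n := r + 1) (by omega) (by omega)
  obtain ⟨x, y, hxy, rfl, rfl⟩ := exists_isFlagGap hF hg
  exact ⟨x, y, (v.between_iff_rk hxy).2 ⟨ha, hb⟩⟩

theorem Between.unique {F : Set V} {v : Δ.Residue F} {x y x' y' : Lat Δ} (h : v.Between x y)
    (h' : v.Between x' y') : x = x' ∧ y = y' := by
  have key : ∀ {x y x' y' : Lat Δ}, v.Between x y → v.Between x' y' → x ≤ x' ∧ y' ≤ y := by
    intro x y x' y' h h'
    constructor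
    · rcases h'.1.le_or_le x h.1.left_mem with h1 | h1
      · exact h1
      · exact absurd (h.2.1.trans (h'.2.2.trans_le h1)) (lt_irrefl _)
    · rcases h'.1.le_or_le y h.1.right_mem with h1 | h1
      · exact absurd (h.2.2.trans_le (h1.trans h'.2.1.le)) (lt_irrefl _)
      · exact h1
  exact ⟨le_antisymm (key h h').1 (key h' h).1, le_antisymm (key h' h).2 (key h h').2⟩

end Residue

theorem rk_persp {v x y x' y' : Lat Δ} (hx : IsCompl x x') (hy : IsCompl y y') (hxv : x ≤ v)
    (hvy : v ≤ y) : (v ⊓ x' ⊔ y').rk + x.rk + y.rk = v.rk + (r + 1) := by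
  have h1 := rk_add_of_isCompl hx
  have h2 := rk_add_of_isCompl hy
  have h3 := rk_sup_add_rk_inf v x'
  have h4 := rk_sup_add_rk_inf (v ⊓ x') y'
  have e1 : v ⊔ x' = ⊤ := (hx.codisjoint.mono_left hxv).eq_top
  have e2 : v ⊓ x' ⊓ y' = ⊥ := (hy.disjoint.mono_left (inf_le_left.trans hvy)).eq_bot
  rw [e1, rk_top] at h3
  rw [e2, rk_bot] at h4
  omega

namespace IsComplFlag

variable {F G : Set V}

theorem exists_image (h : Δ.IsComplFlag F G) (v : Δ.Residue F) :
    ∃ w : Δ.Residue G, ∃ x y, v.Between x y ∧ ∃ x' ∈ Δ.hat G, ∃ y' ∈ Δ.hat G,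
      IsCompl x x' ∧ IsCompl y y' ∧ w.toLat = v.toLat ⊓ x' ⊔ y' := by
  obtain ⟨x, y, hv⟩ := v.exists_between h.left_mem
  obtain ⟨x', hx', hx⟩ := h.exists_right x hv.1.left_mem
  obtain ⟨y', hy', hy⟩ := h.exists_right y hv.1.right_mem
  have hg := hv.1.compl h hx' hy' hx hy
  have hrk := rk_persp hx hy hv.2.1.le hv.2.2.le
  have h1 := rk_add_of_isCompl hx
  have h2 := rk_add_of_isCompl hy
  have h3 := rk_lt hv.2.1
  have h4 := rk_lt hv.2.2
  have hle1 : y' ≤ v.toLat ⊓ x' ⊔ y' := le_sup_right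
  have hle2 : v.toLat ⊓ x' ⊔ y' ≤ x' := sup_le inf_le_right hg.lt.le
  obtain ⟨w, hw⟩ := exists_vert_of_rk (x := v.toLat ⊓ x' ⊔ y') (by omega) (by omega)
  rw [hw] at hle1 hle2 hrk
  refine ⟨⟨w, fun hwG => ?_, insert_mem_of_isFlagGap h.right_mem hg hle1 hle2⟩, x, y, hv, x', hx',
    y', hy', hx, hy, hw.symm⟩
  rcases hg.le_or_le _ (vert_mem_hat.2 hwG) with h5 | h5
  · have := rk_mono h5
    omega
  · have := rk_mono h5
    omega

/-- The perspectivity between complementary flags, as a map. -/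
noncomputable def persp (h : Δ.IsComplFlag F G) (v : Δ.Residue F) : Δ.Residue G :=
  (h.exists_image v).choose

theorem toLat_persp (h : Δ.IsComplFlag F G) {v : Δ.Residue F} {x y x' y' : Lat Δ}
    (hv : v.Between x y) (hx' : x' ∈ Δ.hat G) (hy' : y' ∈ Δ.hat G) (hx : IsCompl x x')
    (hy : IsCompl y y') : (h.persp v).toLat = v.toLat ⊓ x' ⊔ y' := by
  obtain ⟨x₁, y₁, hv₁, x₂, hx₂, y₂, hy₂, hxc, hyc, e⟩ := (h.exists_image v).choose_spec
  obtain ⟨rfl, rfl⟩ := hv.unique hv₁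
  have h1 := rk_add_of_isCompl hx
  have h2 := rk_add_of_isCompl hy
  have h3 := rk_add_of_isCompl hxc
  have h4 := rk_add_of_isCompl hyc
  rw [eq_of_rk_eq h.right_mem hx' hx₂ (by omega), eq_of_rk_eq h.right_mem hy' hy₂ (by omega)]
  exact e

/-- The complementary gap, and the image of `v` in it. -/
theorem exists_between_persp (h : Δ.IsComplFlag F G) {v : Δ.Residue F} {x y : Lat Δ}
    (hv : v.Between x y) : ∃ x' y', IsCompl x x' ∧ IsCompl y y' ∧ (h.persp v).Between y' x' ∧
      (h.persp v).toLat = v.toLat ⊓ x' ⊔ y' := by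
  obtain ⟨x', hx', hx⟩ := h.exists_right x hv.1.left_mem
  obtain ⟨y', hy', hy⟩ := h.exists_right y hv.1.right_mem
  have hg := hv.1.compl h hx' hy' hx hy
  have e := h.toLat_persp hv hx' hy' hx hy
  refine ⟨x', y', hx, hy, (Residue.between_iff_rk _ hg).2 ?_, e⟩
  have hrk := rk_persp hx hy hv.2.1.le hv.2.2.le
  rw [← e] at hrk
  have h1 := rk_add_of_isCompl hx
  have h2 := rk_add_of_isCompl hy
  have h3 := rk_lt hv.2.1
  have h4 := rk_lt hv.2.2
  have h5 : (h.persp v).toLat.rk = Δ.typ (h.persp v).1 := rfl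
  omega

theorem typ_persp (h : Δ.IsComplFlag F G) {v : Δ.Residue F} {x y : Lat Δ}
    (hv : v.Between x y) : Δ.typ (h.persp v).1 + x.rk + y.rk = Δ.typ v.1 + (r + 1) := by
  obtain ⟨x', y', hx, hy, -, e⟩ := h.exists_between_persp hv
  have := rk_persp hx hy hv.2.1.le hv.2.2.le
  rw [← e] at this
  exact this

theorem persp_persp (h : Δ.IsComplFlag F G) (v : Δ.Residue F) :
    h.symm.persp (h.persp v) = v := by
  obtain ⟨x, y, hv⟩ := v.exists_between h.left_mem
  obtain ⟨x', y', hx, hy, hw, e⟩ := h.exists_between_persp hv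
  apply Residue.toLat_injective
  rw [h.symm.toLat_persp hw hv.1.right_mem hv.1.left_mem hy.symm hx.symm, e,
    sup_inf_assoc_of_le y' (inf_le_left.trans hv.2.2.le), hy.symm.inf_eq_bot, sup_bot_eq, sup_comm,
    inf_comm, ← sup_inf_assoc_of_le x' hv.2.1.le, hx.sup_eq_top, top_inf_eq]

/-- The perspectivity between complementary flags. -/
noncomputable def perspEquiv (h : Δ.IsComplFlag F G) : Δ.Residue F ≃ Δ.Residue G where
  toFun := h.persp
  invFun := h.symm.persp
  left_inv := h.persp_persp
  right_inv := h.symm.persp_persp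

theorem persp_mem (h : Δ.IsComplFlag F G) {C C' : Δ.Chamber} (hp : Δ.IsProjection G C C')
    {v : Δ.Residue F} (hv : v.1 ∈ C.1) : (h.persp v).1 ∈ C'.1 := by
  obtain ⟨x, y, hb⟩ := v.exists_between h.left_mem
  obtain ⟨x', y', hx, hy, hw, e⟩ := h.exists_between_persp hb
  have := hp.mem_hat hw.1 (c := v.toLat) (vert_mem_hat.2 hv)
  rw [← e] at this
  exact vert_mem_hat.1 this

theorem isPerspectivity (h : Δ.IsComplFlag F G) : Δ.IsPerspectivity F G h.perspEquiv := by
  refine ⟨opposite_iff.2 h, fun C C' hC hp v => ⟨fun hv => h.persp_mem hp hv, fun hv => ?_⟩⟩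
  have hmem : Δ.typ v.1 ∈ Δ.typ '' C.1 := by rw [C.2.2]; exact Δ.typ_mem _
  obtain ⟨u, hu, hut⟩ := hmem
  have huF : u ∉ F := fun huF => v.typ_notMem ⟨u, huF, hut⟩
  let u' : Δ.Residue F :=
    ⟨u, huF, Δ.down_closed _ C.2.1 _ (Set.insert_subset hu hC)⟩
  obtain ⟨x, y, hb⟩ := v.exists_between h.left_mem
  have hb' : u'.Between x y := by
    rw [Residue.between_iff_rk _ hb.1, show Δ.typ u'.1 = Δ.typ v.1 from hut,
      ← Residue.between_iff_rk _ hb.1]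
    exact hb
  have h1 := h.typ_persp hb
  have h2 := h.typ_persp hb'
  rw [show Δ.typ u'.1 = Δ.typ v.1 from hut] at h2
  have e : (h.persp u').1 = (h.persp v).1 :=
    Δ.typ_injOn _ C'.2.1 (h.persp_mem hp hu) hv (by omega)
  have e' : u' = v := h.perspEquiv.injective (Subtype.ext e)
  rw [← e']
  exact hu

/-- A perspectivity is determined by its action on chambers. -/
theorem eq_perspEquiv (h : Δ.IsComplFlag F G) {θ : Δ.Residue F ≃ Δ.Residue G}
    (hθ : Δ.IsPerspectivity F G θ) : θ = h.perspEquiv := by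
  have key : ∀ (v : Δ.Residue F) (C : Δ.Chamber), F ⊆ C.1 → v.1 ∈ C.1 →
      (h.perspEquiv.symm (θ v)).1 ∈ C.1 := by
    intro v C hC hv
    obtain ⟨C', hC'⟩ := exists_isProjection h.right_mem C
    rw [h.isPerspectivity.2 C C' hC hC', Equiv.apply_symm_apply]
    exact (hθ.2 C C' hC hC' v).1 hv
  ext1 v
  by_contra hne
  set u := h.perspEquiv.symm (θ v) with hu
  have huv : u ≠ v := by
    intro e
    apply hne
    rw [← e, hu, Equiv.apply_symm_apply, ← hu, e]
  obtain ⟨C, hC⟩ := exists_chamber v.2.2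
  have huC := key v C ((Set.subset_insert _ _).trans hC) (hC (Or.inl rfl))
  obtain ⟨D, hD, w, hwD, hwt, hwu, -⟩ := C.exists_third huC u.1 u.1
  have hsub : F ⊆ D.1 := fun z hz => hD ⟨hC (Or.inr hz), fun e => u.2.1 (e ▸ hz)⟩
  have hvD : v.1 ∈ D.1 := hD ⟨hC (Or.inl rfl), fun e => huv (Subtype.ext e.symm)⟩
  have huD := key v D hsub hvD
  exact hwu (Δ.typ_injOn _ D.mem_simplices hwD huD hwt)

end IsComplFlag

/-- Perspectivities shift the types in each gap. -/
theorem IsPerspectivity.typ_add {F G : Set V} {θ : Δ.Residue F ≃ Δ.Residue G}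
    (hθ : Δ.IsPerspectivity F G θ) {a b : ℕ} (hg : IsGap (r + 1) (Δ.typ '' F) a b)
    {v : Δ.Residue F} (ha : a < Δ.typ v.1) (hb : Δ.typ v.1 < b) :
    Δ.typ (θ v).1 + a + b = Δ.typ v.1 + (r + 1) := by
  have h := opposite_iff.1 hθ.1
  obtain ⟨x, y, hxy, rfl, rfl⟩ := exists_isFlagGap h.left_mem hg
  rw [h.eq_perspEquiv hθ]
  exact h.typ_persp ((v.between_iff_rk hxy).2 ⟨ha, hb⟩)

end BuildingA

/-! ### Triangles of pairwise opposite chambers -/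

namespace BuildingA

open BuildingA.Lat

variable {r : ℕ} {V : Type*} {Δ : BuildingA r V}

theorem Lat.isCompl_of_sup_eq_top {x y : Lat Δ} (h : x ⊔ y = ⊤) (hr : x.rk + y.rk ≤ r + 1) :
    IsCompl x y := by
  have h1 := rk_sup_add_rk_inf x y
  rw [h, rk_top] at h1
  exact IsCompl.of_eq (eq_bot_of_rk_eq_zero (by omega)) h

theorem Lat.rk_sup_le (x y : Lat Δ) : (x ⊔ y).rk ≤ x.rk + y.rk := by
  have := rk_sup_add_rk_inf x y
  omega

theorem Lat.sup_eq_of_atoms {a c l : Lat Δ} (ha : a ≤ l) (hc : c ≤ l) (hl : l.rk = 2)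
    (hra : a.rk = 1) (hrc : c.rk = 1) (hne : c ≠ a) : c ⊔ a = l := by
  refine eq_of_le_of_rk_le (sup_le hc ha) ?_
  have h1 := rk_sup_add_rk_inf c a
  have h2 : (c ⊓ a).rk ≠ 1 := by
    intro h
    have e1 := eq_of_le_of_rk_le (inf_le_left : c ⊓ a ≤ c) (by omega)
    have e2 := eq_of_le_of_rk_le (inf_le_right : c ⊓ a ≤ a) (by omega)
    exact hne (e1.symm.trans e2)
  have h3 := rk_mono (inf_le_left : c ⊓ a ≤ c)
  omega

/-- The join of the first `i` members of a sequence. -/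
noncomputable def partialJoin (f : ℕ → Lat Δ) : ℕ → Lat Δ
  | 0 => ⊥
  | i + 1 => partialJoin f i ⊔ f i

/-- A decreasing sequence `u` starting with the top, each member being obtained from the next one
by joining a line `l`. -/
structure IsLineDecomp (u l : ℕ → Lat Δ) : Prop where
  zero : u 0 = ⊤
  step : ∀ j, 2 * (j + 1) ≤ r + 1 → u j = u (j + 1) ⊔ l j
  rk_le : ∀ j, 2 * j ≤ r + 1 → (u j).rk ≤ r + 1 - 2 * j

/-- Two sequences of points spanning a sequence of lines. -/
def SpanLines (l f h : ℕ → Lat Δ) : Prop :=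
  ∀ j, 2 * (j + 1) ≤ r + 1 → f j ⊔ h j = l j ∧ (f j).rk ≤ 1 ∧ (h j).rk ≤ 1

theorem SpanLines.symm {l f h : ℕ → Lat Δ} (hs : SpanLines l f h) : SpanLines l h f :=
  fun j hj => ⟨by rw [sup_comm]; exact (hs j hj).1, (hs j hj).2.2, (hs j hj).2.1⟩

variable {u l f h : ℕ → Lat Δ}

theorem partialJoin_sup_eq_top (hu : IsLineDecomp u l) (hs : SpanLines l f h) {i : ℕ}
    (hi : 2 * i ≤ r + 1) : partialJoin f i ⊔ (partialJoin h i ⊔ u i) = ⊤ := by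
  induction i with
  | zero => rw [hu.zero]; simp
  | succ i ih =>
    have h1 := ih (by omega)
    rw [hu.step i hi, ← (hs i hi).1] at h1
    rw [← h1]
    simp only [partialJoin]
    ac_rfl

theorem rk_partialJoin_le (hs : SpanLines l f h) {i : ℕ} (hi : 2 * i ≤ r + 1) :
    (partialJoin f i).rk ≤ i := by
  induction i with
  | zero => simp [partialJoin]
  | succ i ih =>
    have h1 := ih (by omega)
    have h2 := (hs i hi).2.1
    have h3 := rk_sup_le (partialJoin f i) (f i)
    simp only [partialJoin]
    omega

theorem rk_partialJoin (hu : IsLineDecomp u l) (hs : SpanLines l f h) {i : ℕ}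
    (hi : 2 * i ≤ r + 1) :
    (partialJoin f i).rk = i ∧ (partialJoin f i ⊔ u i).rk = r + 1 - i := by
  have h1 := rk_partialJoin_le hs hi
  have h2 := rk_partialJoin_le hs.symm hi
  have h3 := hu.rk_le i hi
  have h4 := rk_sup_le (partialJoin f i) (u i)
  have h5 := rk_sup_le (partialJoin h i) (u i)
  have h6 := rk_sup_le (partialJoin f i) (partialJoin h i ⊔ u i)
  have h7 := rk_sup_le (partialJoin h i) (partialJoin f i ⊔ u i)
  rw [partialJoin_sup_eq_top hu hs hi, rk_top] at h6
  rw [partialJoin_sup_eq_top hu hs.symm hi, rk_top] at h7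
  omega

theorem exists_chamber_of_lines (hu : IsLineDecomp u l) (hs : SpanLines l f h) :
    ∃ C : Δ.Chamber, ∀ i, 2 * i ≤ r + 1 →
      C.flag i = partialJoin f i ∧ C.flag (r + 1 - i) = partialJoin f i ⊔ u i := by
  let c : ℕ → Lat Δ := fun m =>
    if 2 * m ≤ r + 1 then partialJoin f m else partialJoin f (r + 1 - m) ⊔ u (r + 1 - m)
  have hfl : ∀ j, 2 * (j + 1) ≤ r + 1 → f j ≤ u j := fun j hj => by
    rw [hu.step j hj, ← (hs j hj).1]
    exact le_sup_of_le_right le_sup_left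
  have hmono : Monotone c := by
    apply monotone_nat_of_le_succ
    intro m
    simp only [c]
    by_cases h1 : 2 * (m + 1) ≤ r + 1
    · rw [if_pos h1, if_pos (by omega)]
      exact le_sup_left
    rw [if_neg h1]
    by_cases h2 : 2 * m ≤ r + 1
    · rw [if_pos h2]
      by_cases h3 : 2 * m = r + 1
      · obtain ⟨q, rfl⟩ : ∃ q, m = q + 1 := ⟨m - 1, by omega⟩
        rw [show r + 1 - (q + 1 + 1) = q by omega]
        exact sup_le_sup_left (hfl q (by omega)) _
      · rw [show r + 1 - (m + 1) = m by omega]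
        exact le_sup_left
    · rw [if_neg h2]
      by_cases h3 : m < r + 1
      · obtain ⟨q, hq⟩ : ∃ q, r + 1 - m = q + 1 := ⟨r - m, by omega⟩
        rw [hq, show r + 1 - (m + 1) = q by omega, hu.step q (by omega), ← (hs q (by omega)).1]
        simp only [partialJoin]
        refine sup_le (sup_le_sup_left ?_ _) (le_sup_of_le_right le_sup_left)
        exact le_sup_of_le_right le_sup_left
      · rw [show r + 1 - m = 0 by omega, show r + 1 - (m + 1) = 0 by omega]
  have hlow : ∀ i, 2 * i ≤ r + 1 → c i = partialJoin f i := fun i hi => if_pos hi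
  have hhigh : ∀ i, 2 * i ≤ r + 1 → c (r + 1 - i) = partialJoin f i ⊔ u i := by
    intro i hi
    by_cases h1 : 2 * i = r + 1
    · have h2 := hu.rk_le i hi
      rw [show r + 1 - i = i by omega, hlow i hi, eq_bot_of_rk_eq_zero (x := u i) (by omega),
        sup_bot_eq]
    · simp only [c]
      rw [if_neg (by omega), show r + 1 - (r + 1 - i) = i by omega]
  obtain ⟨C, hC⟩ := Chamber.exists_of_flag hmono (by
    intro i hi
    by_cases h1 : 2 * i ≤ r + 1
    · rw [hlow i h1]
      exact (rk_partialJoin hu hs h1).1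
    · have := hhigh (r + 1 - i) (by omega)
      rw [show r + 1 - (r + 1 - i) = i by omega] at this
      rw [this, (rk_partialJoin hu hs (by omega)).2]
      omega)
  refine ⟨C, fun i hi => ⟨?_, ?_⟩⟩
  · rw [hC i (by omega), hlow i hi]
  · rw [hC _ (by omega), hhigh i hi]

/-- Chambers with complementary flags. -/
def Chamber.IsOpp (C D : Δ.Chamber) : Prop :=
  ∀ i ≤ r + 1, IsCompl (C.flag i) (D.flag (r + 1 - i))

theorem Chamber.IsOpp.symm {C D : Δ.Chamber} (h : C.IsOpp D) : D.IsOpp C := by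
  intro i hi
  have := (h (r + 1 - i) (by omega)).symm
  rwa [show r + 1 - (r + 1 - i) = i by omega] at this

theorem isOpp_of_lines (hu : IsLineDecomp u l) (hs : SpanLines l f h) {C D : Δ.Chamber}
    (hC : ∀ i, 2 * i ≤ r + 1 →
      C.flag i = partialJoin f i ∧ C.flag (r + 1 - i) = partialJoin f i ⊔ u i)
    (hD : ∀ i, 2 * i ≤ r + 1 →
      D.flag i = partialJoin h i ∧ D.flag (r + 1 - i) = partialJoin h i ⊔ u i) :
    C.IsOpp D := by
  have key : ∀ {f h : ℕ → Lat Δ} {C D : Δ.Chamber}, SpanLines l f h →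
      (∀ i, 2 * i ≤ r + 1 →
        C.flag i = partialJoin f i ∧ C.flag (r + 1 - i) = partialJoin f i ⊔ u i) →
      (∀ i, 2 * i ≤ r + 1 →
        D.flag i = partialJoin h i ∧ D.flag (r + 1 - i) = partialJoin h i ⊔ u i) →
      ∀ i, 2 * i ≤ r + 1 → IsCompl (C.flag i) (D.flag (r + 1 - i)) := by
    intro f h C D hs hC hD i hi
    rw [(hC i hi).1, (hD i hi).2]
    refine isCompl_of_sup_eq_top (partialJoin_sup_eq_top hu hs hi) ?_
    rw [(rk_partialJoin hu hs hi).1, (rk_partialJoin hu hs.symm hi).2]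
    omega
  intro i hi
  by_cases h1 : 2 * i ≤ r + 1
  · exact key hs hC hD i h1
  · have := (key hs.symm hD hC (r + 1 - i) (by omega)).symm
    rwa [show r + 1 - (r + 1 - i) = i by omega] at this

/-- Every chamber belongs to a triangle of pairwise opposite chambers, whose flags have common
relative complements `u i`. -/
theorem exists_triangle (C : Δ.Chamber) : ∃ (C' C'' : Δ.Chamber) (u : ℕ → Lat Δ),
    C.IsOpp C' ∧ C'.IsOpp C'' ∧ C''.IsOpp C ∧ ∀ i, 2 * i ≤ r + 1 →
      C.flag (r + 1 - i) = C.flag i ⊔ u i ∧ C'.flag (r + 1 - i) = C'.flag i ⊔ u i ∧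
        C''.flag (r + 1 - i) = C''.flag i ⊔ u i := by
  obtain ⟨A, hA, e, he, -, -, H⟩ := exists_common_chart C.mem_simplices C.mem_simplices
  choose X hX using fun i => H (C.flag i) (Or.inl (C.flag_mem i))
  have hsub : ∀ {i j}, i ≤ j → X i ⊆ X j := by
    intro i j hij
    rw [← latChart_le_iff hA he, hX, hX]
    exact C.flag_mono hij
  have hcard : ∀ i ≤ r + 1, (X i).card = i := by
    intro i hi
    rw [← rk_latChart he, hX, C.rk_flag hi]
  have hcd : ∀ i j, i ≤ j → j ≤ r + 1 → (X j \ X i).card = j - i := by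
    intro i j hij hj
    rw [Finset.card_sdiff_of_subset (hsub hij), hcard j hj, hcard i (by omega)]
  let E := Δ.latChart e
  have hEr : ∀ Y, (E Y).rk = Y.card := rk_latChart he
  have hEs : ∀ Y Z, E (Y ∪ Z) = E Y ⊔ E Z := latChart_sup hA he
  let u : ℕ → Lat Δ := fun i => E (X (r + 1 - i) \ X i)
  let a : ℕ → Lat Δ := fun j => E (X (j + 1) \ X j)
  let b : ℕ → Lat Δ := fun j => E (X (r + 1 - j) \ X (r + 1 - (j + 1)))
  let l : ℕ → Lat Δ := fun j => a j ⊔ b j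
  have hu : IsLineDecomp u l := by
    refine ⟨?_, fun j hj => ?_, fun j hj => ?_⟩
    · apply eq_top_of_rk_eq
      simp only [u]
      rw [hEr, hcd _ _ (by omega) (by omega)]
      omega
    · simp only [u, l, a, b]
      rw [← hEs, ← hEs]
      congr 1
      ext t
      have h1 := @hsub j (j + 1) (by omega) t
      have h2 := @hsub (j + 1) (r + 1 - (j + 1)) (by omega) t
      have h3 := @hsub (r + 1 - (j + 1)) (r + 1 - j) (by omega) t
      simp only [Finset.mem_union, Finset.mem_sdiff]
      tauto
    · simp only [u]
      rw [hEr, hcd _ _ (by omega) (by omega)]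
      omega
  have har : ∀ j, 2 * (j + 1) ≤ r + 1 → (a j).rk = 1 := by
    intro j hj
    simp only [a]
    rw [hEr, hcd _ _ (by omega) (by omega)]
    omega
  have hbr : ∀ j, 2 * (j + 1) ≤ r + 1 → (b j).rk = 1 := by
    intro j hj
    simp only [b]
    rw [hEr, hcd _ _ (by omega) (by omega)]
    omega
  have hlr : ∀ j, 2 * (j + 1) ≤ r + 1 → (l j).rk = 2 := by
    intro j hj
    have ha := har j hj
    have hb := hbr j hj
    simp only [a, b] at ha hb
    rw [hEr] at ha hb
    simp only [l, a, b]
    rw [← hEs, hEr, Finset.card_union_of_disjoint, ha, hb]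
    rw [Finset.disjoint_left]
    intro t ht ht'
    rw [Finset.mem_sdiff] at ht ht'
    exact ht'.2 (hsub (by omega) ht.1)
  have hthird : ∀ j, ∃ c, 2 * (j + 1) ≤ r + 1 → c ≤ l j ∧ c.rk = 1 ∧ c ≠ a j ∧ c ≠ b j := by
    intro j
    by_cases hj : 2 * (j + 1) ≤ r + 1
    · obtain ⟨c, h1, h2, h3, h4⟩ := exists_third_atom (hlr j hj) (a j) (b j)
      exact ⟨c, fun _ => ⟨h1, h2, h3, h4⟩⟩
    · exact ⟨⊥, fun h => absurd h hj⟩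
  choose c hc using hthird
  have hab : SpanLines l a b := fun j hj => ⟨rfl, (har j hj).le, (hbr j hj).le⟩
  have hca : SpanLines l c a := fun j hj =>
    ⟨sup_eq_of_atoms le_sup_left (hc j hj).1 (hlr j hj) (har j hj) (hc j hj).2.1 (hc j hj).2.2.1,
      (hc j hj).2.1.le, (har j hj).le⟩
  have hcb : SpanLines l c b := fun j hj =>
    ⟨sup_eq_of_atoms le_sup_right (hc j hj).1 (hlr j hj) (hbr j hj) (hc j hj).2.1 (hc j hj).2.2.2,
      (hc j hj).2.1.le, (hbr j hj).le⟩
  have hCa : ∀ i, 2 * i ≤ r + 1 → C.flag i = partialJoin a i := by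
    intro i
    induction i with
    | zero => intro _; exact C.flag_zero
    | succ i ih =>
      intro hi
      simp only [partialJoin]
      rw [← ih (by omega), ← hX, ← hX, ← latChart_sup hA he,
        Finset.union_sdiff_of_subset (hsub (Nat.le_succ i))]
  have hC : ∀ i, 2 * i ≤ r + 1 →
      C.flag i = partialJoin a i ∧ C.flag (r + 1 - i) = partialJoin a i ⊔ u i := by
    intro i hi
    refine ⟨hCa i hi, ?_⟩
    rw [← hCa i hi, ← hX, ← hX, ← latChart_sup hA he,
      Finset.union_sdiff_of_subset (hsub (by omega))]
  obtain ⟨C', hC'⟩ := exists_chamber_of_lines hu hab.symm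
  obtain ⟨C'', hC''⟩ := exists_chamber_of_lines hu hca
  refine ⟨C', C'', u, isOpp_of_lines hu hab hC hC', isOpp_of_lines hu hcb.symm hC' hC'',
    isOpp_of_lines hu hca hC'' hC, fun i hi => ⟨?_, ?_, ?_⟩⟩
  · rw [(hC i hi).1, (hC i hi).2]
  · rw [(hC' i hi).1, (hC' i hi).2]
  · rw [(hC'' i hi).1, (hC'' i hi).2]

/-! ### Subflags of given type -/

namespace Chamber

/-- The face of type `J` of a chamber. -/
def face (C : Δ.Chamber) (J : Set ℕ) : Set V := {v | v ∈ C.1 ∧ Δ.typ v ∈ J}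

theorem face_subset (C : Δ.Chamber) (J : Set ℕ) : C.face J ⊆ C.1 := fun _ h => h.1

theorem face_mem_simplices (C : Δ.Chamber) (J : Set ℕ) : C.face J ∈ Δ.simplices :=
  Δ.down_closed _ C.mem_simplices _ (C.face_subset J)

theorem eq_face {C : Δ.Chamber} {F : Set V} (h : F ⊆ C.1) : F = C.face (Δ.typ '' F) := by
  apply subset_antisymm
  · intro v hv
    exact ⟨h hv, v, hv, rfl⟩
  · rintro v ⟨hv, w, hw, hwv⟩
    rwa [← Δ.typ_injOn _ C.mem_simplices (h hw) hv hwv]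

theorem flag_mem_hat_face (C : Δ.Chamber) {J : Set ℕ} {i : ℕ} (hi : i = 0 ∨ r + 1 ≤ i ∨ i ∈ J) :
    C.flag i ∈ Δ.hat (C.face J) := by
  by_cases h0 : i = 0
  · rw [h0, C.flag_zero]; exact bot_mem_hat _
  by_cases h1 : r + 1 ≤ i
  · rw [C.flag_top h1]; exact top_mem_hat _
  have hiJ : i ∈ J := by tauto
  intro v hv
  have hv' := mem_verts.1 hv
  have ht : Δ.typ v = i := by
    rw [← rk_vert (Δ := Δ), ← hv', C.rk_flag (by omega)]
  exact ⟨by rw [C.mem_iff_flag, ht, hv'], by rw [ht]; exact hiJ⟩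

theorem rk_mem_of_mem_hat_face {C : Δ.Chamber} {J : Set ℕ} {x : Lat Δ}
    (hx : x ∈ Δ.hat (C.face J)) : x.rk = 0 ∨ x.rk = r + 1 ∨ x.rk ∈ J := by
  rcases rk_mem_of_mem_hat hx with h | h | ⟨v, hv, h⟩
  · exact Or.inl h
  · exact Or.inr (Or.inl h)
  · exact Or.inr (Or.inr (h ▸ hv.2))

theorem IsOpp.isComplFlag {C D : Δ.Chamber} (h : C.IsOpp D) {J : Set ℕ}
    (hJ : ∀ t ∈ J, r + 1 - t ∈ J) : Δ.IsComplFlag (C.face J) (D.face J) := by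
  have key : ∀ {C D : Δ.Chamber}, C.IsOpp D →
      ∀ x ∈ Δ.hat (C.face J), ∃ y ∈ Δ.hat (D.face J), IsCompl x y := by
    intro C D h x hx
    refine ⟨D.flag (r + 1 - x.rk), D.flag_mem_hat_face ?_, ?_⟩
    · rcases rk_mem_of_mem_hat_face hx with h | h | h
      · right; left; omega
      · left; omega
      · exact Or.inr (Or.inr (hJ _ h))
    · have := h x.rk (rk_le x)
      rwa [C.flag_eq (hat_mono (C.face_subset J) hx)] at this
  exact ⟨C.face_mem_simplices J, D.face_mem_simplices J, key h, key h.symm⟩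

theorem isFlagGap_face_outerTypes (C : Δ.Chamber) {k : ℕ} (hk : 2 * k < r) :
    IsFlagGap (C.face (outerTypes r k)) (C.flag k) (C.flag (r + 1 - k)) := by
  have hmem : ∀ t, t ∈ outerTypes r k ↔ 1 ≤ t ∧ t ≤ k ∨ r - k + 1 ≤ t ∧ t ≤ r := fun t => by
    simp [outerTypes]
  have h1 : C.flag k ∈ Δ.hat (C.face (outerTypes r k)) := by
    apply C.flag_mem_hat_face
    rw [hmem]
    omega
  have h2 : C.flag (r + 1 - k) ∈ Δ.hat (C.face (outerTypes r k)) := by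
    apply C.flag_mem_hat_face
    rw [hmem]
    omega
  refine ⟨h1, h2, C.flag_lt (by omega) (by omega), fun z hz => ?_⟩
  have hz' := rk_mem_of_mem_hat_face hz
  rw [hmem] at hz'
  have hk1 := C.rk_flag (i := k) (by omega)
  have hk2 := C.rk_flag (i := r + 1 - k) (by omega)
  by_cases h : z.rk ≤ k
  · exact Or.inl (le_of_rk_le (C.face_mem_simplices _) hz h1 (by omega))
  · exact Or.inr (le_of_rk_le (C.face_mem_simplices _) h2 hz (by omega))

theorem between_face_outerTypes (C : Δ.Chamber) {k : ℕ} (hk : 2 * k < r)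
    (v : Δ.Residue (C.face (outerTypes r k))) :
    v.Between (C.flag k) (C.flag (r + 1 - k)) := by
  rw [Residue.between_iff_rk _ (C.isFlagGap_face_outerTypes hk), C.rk_flag (by omega),
    C.rk_flag (by omega)]
  have hv : Δ.typ v.1 ∉ outerTypes r k := by
    intro ht
    refine v.typ_notMem ?_
    have hmem : Δ.typ v.1 ∈ Δ.typ '' C.1 := by rw [C.2.2]; exact Δ.typ_mem v.1
    obtain ⟨w, hw, hwt⟩ := hmem
    exact ⟨w, ⟨hw, by rw [hwt]; exact ht⟩, hwt⟩
  have h1 : 1 ≤ Δ.typ v.1 := (Δ.typ_mem v.1).1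
  have h2 : Δ.typ v.1 ≤ r := (Δ.typ_mem v.1).2
  simp only [outerTypes, Set.mem_union, Set.mem_Icc] at hv
  omega

theorem toLat_persp_face {C D : Δ.Chamber} {k : ℕ} (hk : 2 * k < r)
    (h : Δ.IsComplFlag (C.face (outerTypes r k)) (D.face (outerTypes r k))) (hCD : C.IsOpp D)
    {w u : Lat Δ} (hD : D.flag (r + 1 - k) = D.flag k ⊔ u) (hw : w ≤ u)
    {v : Δ.Residue (C.face (outerTypes r k))} (hv : v.toLat = w ⊔ C.flag k) :
    (h.persp v).toLat = w ⊔ D.flag k := by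
  have hg := D.isFlagGap_face_outerTypes hk
  have h1 := hCD k (by omega)
  have h2 := hCD (r + 1 - k) (by omega)
  rw [show r + 1 - (r + 1 - k) = k by omega] at h2
  rw [h.toLat_persp (C.between_face_outerTypes hk v) hg.right_mem hg.left_mem h1 h2, hv,
    sup_inf_assoc_of_le, h1.inf_eq_bot, sup_bot_eq]
  rw [hD]
  exact hw.trans le_sup_right

end Chamber

theorem sub_mem_outerTypes {r k : ℕ} (hk : 2 * k < r) :
    ∀ t ∈ outerTypes r k, r + 1 - t ∈ outerTypes r k := by
  intro t
  simp only [outerTypes, Set.mem_union, Set.mem_Icc]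
  omega

/-- The identity is a product of three perspectivities. -/
theorem exists_three_perspectivities {k : ℕ} (hk : 2 * k < r) {F : Set V}
    (hF : F ∈ Δ.simplices) (hFk : Δ.typ '' F = outerTypes r k) :
    ∃ (F' F'' : Set V) (θ₁ : Δ.Residue F ≃ Δ.Residue F')
      (θ₂ : Δ.Residue F' ≃ Δ.Residue F'') (θ₃ : Δ.Residue F'' ≃ Δ.Residue F),
      Δ.IsPerspectivity F F' θ₁ ∧ Δ.IsPerspectivity F' F'' θ₂ ∧ Δ.IsPerspectivity F'' F θ₃ ∧
        (θ₁.trans θ₂).trans θ₃ = Equiv.refl (Δ.Residue F) := by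
  obtain ⟨C, hC⟩ := exists_chamber hF
  have e := Chamber.eq_face hC
  rw [hFk] at e
  subst e
  obtain ⟨C', C'', u, h1, h2, h3, hu⟩ := exists_triangle C
  have c1 := h1.isComplFlag (J := outerTypes r k) (sub_mem_outerTypes hk)
  have c2 := h2.isComplFlag (J := outerTypes r k) (sub_mem_outerTypes hk)
  have c3 := h3.isComplFlag (J := outerTypes r k) (sub_mem_outerTypes hk)
  refine ⟨_, _, c1.perspEquiv, c2.perspEquiv, c3.perspEquiv, c1.isPerspectivity,
    c2.isPerspectivity, c3.isPerspectivity, ?_⟩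
  ext1 v
  obtain ⟨u1, u2, u3⟩ := hu k (by omega)
  have hb := C.between_face_outerTypes hk v
  have hv : v.toLat = u k ⊓ v.toLat ⊔ C.flag k := by
    rw [sup_comm, ← sup_inf_assoc_of_le (u k) hb.2.1.le, ← u1]
    exact (inf_eq_right.2 hb.2.2.le).symm
  have s1 := Chamber.toLat_persp_face hk c1 h1 u2 inf_le_left hv
  have s2 := Chamber.toLat_persp_face hk c2 h2 u3 inf_le_left s1
  have s3 := Chamber.toLat_persp_face hk c3 h3 u1 inf_le_left s2
  apply Residue.toLat_injective
  exact s3.trans hv.symm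

end BuildingA

/-! ### Projectivity groups -/

namespace BuildingA

variable {r : ℕ} {V : Type*} {Δ : BuildingA r V}

theorem IsProjectivity.trans {m n : ℕ} {F G H : Set V} {θ : Δ.Residue F ≃ Δ.Residue G}
    {η : Δ.Residue G ≃ Δ.Residue H} (hθ : Δ.IsProjectivity m F G θ)
    (hη : Δ.IsProjectivity n G H η) : Δ.IsProjectivity (m + n) F H (θ.trans η) := by
  induction hη with
  | refl => exact hθ
  | step n G H K η ζ _ hζ ih =>
    exact IsProjectivity.step (m + n) F H K (θ.trans η) ζ (ih hθ) hζ

theorem IsPerspectivity.isProjectivity {F G : Set V} {θ : Δ.Residue F ≃ Δ.Residue G}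
    (h : Δ.IsPerspectivity F G θ) : Δ.IsProjectivity 1 F G θ :=
  IsProjectivity.step 0 F F G (Equiv.refl _) θ (IsProjectivity.refl F) h

theorem projIndex_eq_one_iff {F : Set V} :
    Δ.projIndex F = 1 ↔ Δ.generalGroup F ≤ Δ.specialGroup F :=
  Subgroup.relIndex_eq_one

theorem IsPerspectivity.typ_image {F G : Set V} {θ : Δ.Residue F ≃ Δ.Residue G}
    (h : Δ.IsPerspectivity F G θ) : Δ.typ '' G = oppTypes r (Δ.typ '' F) := by
  rw [(opposite_iff.1 h.1).typ_image, oppTypes_eq]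
  rintro _ ⟨v, -, rfl⟩
  exact Δ.typ_mem v

theorem oppTypes_oppTypes {J : Set ℕ} (hJ : J ⊆ Set.Icc 1 r) :
    oppTypes r (oppTypes r J) = J := by
  have h1 : oppTypes r J ⊆ Set.Icc 1 r := by
    rw [oppTypes_eq hJ]
    rintro t ⟨h1, h2⟩
    have := hJ h2
    simp only [Set.mem_Icc] at this ⊢
    omega
  rw [oppTypes_eq h1, oppTypes_eq hJ]
  ext t
  constructor
  · rintro ⟨ht, -, h2⟩
    rwa [show r + 1 - (r + 1 - t) = t by omega] at h2
  · intro ht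
    have := hJ ht
    simp only [Set.mem_Icc] at this
    refine ⟨this.2, by omega, ?_⟩
    rwa [show r + 1 - (r + 1 - t) = t by omega]

theorem typ_image_subset (F : Set V) : Δ.typ '' F ⊆ Set.Icc 1 r := by
  rintro _ ⟨v, -, rfl⟩
  exact Δ.typ_mem v

theorem IsProjectivity.typ_image {n : ℕ} {F G : Set V} {θ : Δ.Residue F ≃ Δ.Residue G}
    (h : Δ.IsProjectivity n F G θ) :
    Δ.typ '' G = if Even n then Δ.typ '' F else oppTypes r (Δ.typ '' F) := by
  induction h with
  | refl => simp
  | step n F G H θ η _ hη ih =>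
    rw [hη.typ_image, ih]
    by_cases hn : Even n
    · rw [if_pos hn, if_neg (by rwa [Nat.even_add_one, not_not])]
    · rw [if_neg hn, if_pos (Nat.even_add_one.2 hn), oppTypes_oppTypes (typ_image_subset F)]

theorem generalGroup_le_of_oppTypes_ne {F : Set V} (h : oppTypes r (Δ.typ '' F) ≠ Δ.typ '' F) :
    Δ.generalGroup F ≤ Δ.specialGroup F := by
  apply Subgroup.closure_mono
  rintro θ ⟨n, hn⟩
  refine ⟨n, ?_, hn⟩
  by_contra hodd
  have := hn.typ_image
  rw [if_neg hodd] at this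
  exact h this.symm

theorem generalGroup_le_of_odd_refl {F : Set V} {m : ℕ} (hm : Odd m)
    (h : Δ.IsProjectivity m F F (Equiv.refl _)) : Δ.generalGroup F ≤ Δ.specialGroup F := by
  apply Subgroup.closure_mono
  rintro θ ⟨n, hn⟩
  rcases Nat.even_or_odd n with he | ho
  · exact ⟨n, he, hn⟩
  · refine ⟨n + m, ho.add_odd hm, ?_⟩
    have := hn.trans h
    rwa [Equiv.trans_refl] at this

theorem _root_.IsGap.flip {J : Set ℕ} (hJ : J ⊆ Set.Icc 1 r) (hs : oppTypes r J = J) {a b : ℕ}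
    (h : IsGap (r + 1) J a b) : IsGap (r + 1) J (r + 1 - b) (r + 1 - a) := by
  have hflip : ∀ t ∈ J, r + 1 - t ∈ J := by
    intro t ht
    rw [← hs, oppTypes_eq hJ] at ht
    exact ht.2
  obtain ⟨hab, hb, ha0, hbn, hg⟩ := h
  refine ⟨by omega, by omega, ?_, ?_, fun s hsJ => ?_⟩
  · rcases hbn with rfl | h
    · left; omega
    · exact Or.inr (hflip b h)
  · rcases ha0 with rfl | h
    · left; omega
    · exact Or.inr (hflip a h)
  · have h1 := hg _ (hflip s hsJ)
    have h2 := hJ hsJ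
    simp only [Set.mem_Icc] at h2
    omega

/-- In a gap of a self-opposite set of types, even projectivities preserve the types and odd
ones shift them. -/
theorem IsProjectivity.typ_add {n : ℕ} {F G : Set V} {θ : Δ.Residue F ≃ Δ.Residue G}
    (h : Δ.IsProjectivity n F G θ) (hs : oppTypes r (Δ.typ '' F) = Δ.typ '' F) {a b : ℕ}
    (hg : IsGap (r + 1) (Δ.typ '' F) a b) {v : Δ.Residue F} (ha : a < Δ.typ v.1)
    (hb : Δ.typ v.1 < b) :
    (Even n → Δ.typ (θ v).1 = Δ.typ v.1) ∧
      (¬ Even n → Δ.typ (θ v).1 + a + b = Δ.typ v.1 + (r + 1)) := by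
  induction h with
  | refl => simp
  | step n F G H θ η hθ hη ih =>
    have hbn := hg.2.1
    have hG : Δ.typ '' G = Δ.typ '' F := by
      rw [hθ.typ_image]
      split_ifs
      · rfl
      · exact hs
    obtain ⟨h1, h2⟩ := ih hs hg ha hb
    rw [Nat.even_add_one]
    simp only [Equiv.trans_apply, not_not]
    by_cases hn : Even n
    · refine ⟨fun h => absurd hn h, fun _ => ?_⟩
      have h3 := h1 hn
      have := hη.typ_add (v := θ v) (by rw [hG]; exact hg) (by rw [h3]; exact ha)
        (by rw [h3]; exact hb)
      rw [this, h3]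
    · refine ⟨fun _ => ?_, fun h => absurd h hn⟩
      have h3 := h2 hn
      have := hη.typ_add (v := θ v) (by rw [hG]; exact hg.flip (typ_image_subset F) hs)
        (by omega) (by omega)
      omega

theorem not_generalGroup_le_of_gap {F : Set V} (hF : F ∈ Δ.simplices)
    (hs : oppTypes r (Δ.typ '' F) = Δ.typ '' F) {t a b : ℕ} (ht : t ∈ Set.Icc 1 r)
    (hg : IsGap (r + 1) (Δ.typ '' F) a b) (ha : a < t) (hb : t < b) (hab : a + b ≠ r + 1) :
    ¬ Δ.generalGroup F ≤ Δ.specialGroup F := by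
  intro hle
  have htF : t ∉ Δ.typ '' F := by
    intro h
    have := hg.2.2.2.2 t h
    omega
  obtain ⟨v, rfl, hv⟩ := exists_insert hF ht htF
  let v' : Δ.Residue F := ⟨v, fun h => htF ⟨v, h, rfl⟩, hv⟩
  have hspecial : ∀ θ ∈ Δ.specialGroup F, ∀ w : Δ.Residue F, Δ.typ (θ w).1 = Δ.typ w.1 := by
    intro θ hθ
    induction hθ using Subgroup.closure_induction with
    | mem θ h =>
      intro w
      obtain ⟨n, hn, hθ⟩ := h
      have hw := Δ.typ_mem w.1
      simp only [Set.mem_Icc] at hw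
      obtain ⟨a, b, hg, ha, hb⟩ := exists_isGap w.typ_notMem (n := r + 1) (by omega) (by omega)
      exact (hθ.typ_add hs hg ha hb).1 hn
    | one => intro w; rfl
    | mul θ η _ _ h1 h2 => intro w; rw [Equiv.Perm.mul_apply, h1, h2]
    | inv θ _ h =>
      intro w
      have := h (θ⁻¹ w)
      rw [← this]
      exact congrArg (fun x : Δ.Residue F => Δ.typ x.1) (θ.apply_symm_apply w)
  obtain ⟨C, hC⟩ := exists_chamber hF
  have e := Chamber.eq_face hC
  obtain ⟨C', C'', u, h1, h2, h3, -⟩ := exists_triangle C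
  have hJ : ∀ t ∈ Δ.typ '' F, r + 1 - t ∈ Δ.typ '' F := by
    intro t ht
    rw [← hs, oppTypes_eq (typ_image_subset F)] at ht
    exact ht.2
  have c1 := h1.isComplFlag hJ
  have c2 := h2.isComplFlag hJ
  have c3 := h3.isComplFlag hJ
  rw [← e] at c1 c3
  have hodd : Δ.IsProjectivity 3 F F _ :=
    (c1.isPerspectivity.isProjectivity.trans c2.isPerspectivity.isProjectivity).trans
      c3.isPerspectivity.isProjectivity
  have h4 := (hodd.typ_add hs hg (v := v') ha hb).2 (by decide)
  have h5 := hspecial _ (hle (Subgroup.subset_closure ⟨3, hodd⟩)) v'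
  omega

end BuildingA

theorem exists_gap_of_not_outer {r : ℕ} {J : Set ℕ} (hJ : J ⊂ Set.Icc 1 r)
    (hn : ¬ ∃ k, 2 * k ≤ r - 1 ∧ J = outerTypes r k) :
    ∃ t ∈ Set.Icc 1 r, ∃ a b, IsGap (r + 1) J a b ∧ a < t ∧ t < b ∧ a + b ≠ r + 1 := by
  by_contra! hcon
  obtain ⟨t, ht, htJ⟩ := Set.exists_of_ssubset hJ
  have ht' : 1 ≤ t ∧ t ≤ r := ht
  obtain ⟨a, b, hg, ha, hb⟩ := exists_isGap htJ (n := r + 1) (by omega) (by omega)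
  have hab := hcon t ht a b hg ha hb
  refine hn ⟨a, by omega, ?_⟩
  ext s
  simp only [outerTypes, Set.mem_union, Set.mem_Icc]
  constructor
  · intro hs
    have h1 := hJ.1 hs
    have h2 := hg.2.2.2.2 s hs
    simp only [Set.mem_Icc] at h1
    omega
  · intro hs
    by_contra hsJ
    obtain ⟨a', b', hg', ha', hb'⟩ := exists_isGap hsJ (n := r + 1) (by omega) (by omega)
    have hab' := hcon s ⟨by omega, by omega⟩ a' b' hg' ha' hb'
    have h1 : a = 0 ∨ a ≤ a' ∨ b' ≤ a := hg.2.2.1.imp_right (hg'.2.2.2.2 a)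
    have h2 : a' = 0 ∨ a' ≤ a ∨ b ≤ a' := hg'.2.2.1.imp_right (hg.2.2.2.2 a')
    have := hg.2.1
    have := hg'.2.1
    omega

theorem mainTheorem7 {r : ℕ} {V : Type*} (Δ : BuildingA r V) (J : Set ℕ)
    (hJ : J ⊂ Set.Icc 1 r) :
    (PolarClosed r J ↔
      ∃ k : ℕ, 2 * k ≤ r - 1 ∧ J.ncard = 2 * k ∧ J = Set.Icc 1 k ∪ Set.Icc (r - k + 1) r) ∧
    ∀ F ∈ Δ.simplices, Δ.typ '' F = J →
      (Δ.projIndex F = 1 ↔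
        oppTypes r J ≠ J ∨
          ∃ k : ℕ, 2 * k ≤ r - 1 ∧ J.ncard = 2 * k ∧
            J = Set.Icc 1 k ∪ Set.Icc (r - k + 1) r) ∧
      (PolarClosed r J →
        ∃ (F' F'' : Set V) (θ₁ : Δ.Residue F ≃ Δ.Residue F')
          (θ₂ : Δ.Residue F' ≃ Δ.Residue F'') (θ₃ : Δ.Residue F'' ≃ Δ.Residue F),
          Δ.IsPerspectivity F F' θ₁ ∧ Δ.IsPerspectivity F' F'' θ₂ ∧ Δ.IsPerspectivity F'' F θ₃ ∧
            (θ₁.trans θ₂).trans θ₃ = Equiv.refl (Δ.Residue F)) := by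
  have hr : 1 ≤ r := by
    obtain ⟨t, ht, -⟩ := Set.exists_of_ssubset hJ
    exact ht.1.trans ht.2
  refine ⟨polarClosed_iff hJ, ?_⟩
  rintro F hF rfl
  refine ⟨?_, fun h => ?_⟩
  · rw [BuildingA.projIndex_eq_one_iff]
    constructor
    · intro hle
      by_contra! hcon
      obtain ⟨t, ht, a, b, hg, ha, hb, hab⟩ := exists_gap_of_not_outer hJ
        (by
          rintro ⟨k, hk, e⟩
          refine hcon.2 k hk ?_ e
          rw [e]
          exact ncard_outerTypes (by omega))
      exact BuildingA.not_generalGroup_le_of_gap hF hcon.1 ht hg ha hb hab hle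
    · rintro (h | ⟨k, hk, -, e⟩)
      · exact BuildingA.generalGroup_le_of_oppTypes_ne h
      · obtain ⟨F', F'', θ₁, θ₂, θ₃, h1, h2, h3, hid⟩ :=
          BuildingA.exists_three_perspectivities (by omega) hF e
        have hodd := (h1.isProjectivity.trans h2.isProjectivity).trans h3.isProjectivity
        rw [hid] at hodd
        exact BuildingA.generalGroup_le_of_odd_refl (by decide) hodd
  · obtain ⟨k, hk, -, e⟩ := (polarClosed_iff hJ).1 h
    exact BuildingA.exists_three_perspectivities (by omega) hF e
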